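/- Let $L/K$ be a cyclic field extension (that is, a finite Galois extension of fields with cyclic Galois group) of squarefree degree $n$. A Hopf-Galois structure on $L/K$ is a cocommutative $K$-Hopf algebra $H$ together with a $K$-linear action of $H$ on $L$ making $L$ an $H$-module algebra (so $h\cdot(xy)=\sum_{(h)}(h_{(1)}\cdot x)(h_{(2)}\cdot y)$ and $h\cdot k=\epsilon(h)k$ for all $h\in H$, $x,y\in L$, $k\in K$), such that the $K$-linear map $\theta\colon L\otimes_K L\to \operatorname{Hom}_K(H,L)$, $\theta(x\otimes y)(h)=x\,(h\cdot y)$, is bijective; two such structures are identified if there is an isomorphism of $K$-Hopf algebras between them that is compatible with the actions on $L$. Then the number of Hopf-Galois structures on $L/K$ is finite and equals $$\sum_{dgz=n} 2^{\omega(g)}\,\mu(z)\prod_{p\mid d}\left(p^{v(p,g)}-1\right),$$ where the sum is over all ordered triples $(d,g,z)$ of positive integers with $dgz=n$, the product is over the primes $p$ dividing $d$, $\omega(g)$ is the number of distinct prime factors of $g$, $\mu$ is the Möbius function, and $v(p,g)$ is the number of distinct prime factors $q$ of $g$ with $q\equiv 1\pmod p$. -/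

import Mathlib

open scoped TensorProduct

universe u v

section HopfGalois

variable (K : Type u) (L : Type v) [Field K] [Field L] [Algebra K L]

/-- For a `K`-algebra `H` acting `K`-linearly on `L` through `ρ`, the `K`-linear map
`θ : L ⊗ L → Hom_K(H, L)` with `θ (x ⊗ y) h = x * (h · y)`. -/
noncomputable def hopfGaloisTheta {K : Type u} {L : Type v} [Field K] [Field L] [Algebra K L]
    {H : Type u} [Ring H] [Algebra K H] (ρ : H →ₐ[K] Module.End K L) :
    L ⊗[K] L →ₗ[K] (H →ₗ[K] L) :=
  TensorProduct.lift
    (LinearMap.mk₂ K (fun x y => LinearMap.mulLeft K x ∘ₗ ρ.toLinearMap.flip y)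
      (fun x₁ x₂ y => by ext h; simp [add_mul])
      (fun c x y => by ext h; simp)
      (fun x y₁ y₂ => by ext h; simp [mul_add])
      (fun c x y => by ext h; simp))

theorem hopfGaloisTheta_tmul {K : Type u} {L : Type v} [Field K] [Field L] [Algebra K L]
    {H : Type u} [Ring H] [Algebra K H] (ρ : H →ₐ[K] Module.End K L) (x y : L) (h : H) :
    hopfGaloisTheta ρ (x ⊗ₜ[K] y) h = x * ρ h y := by
  simp [hopfGaloisTheta]

/-- A Hopf-Galois structure on `L/K`: a cocommutative `K`-Hopf algebra `H` with an action on `L`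
making `L` an `H`-module algebra, such that `θ : L ⊗ L → Hom_K(H, L)` is bijective.
When `L/K` is finite, bijectivity of `θ` forces `H` to be finite-dimensional over `K`, so nothing
is lost by taking `H` in the universe of `K`. -/
structure HopfGaloisStructure where
  /-- The underlying type of the Hopf algebra. -/
  H : Type u
  [ring : Ring H]
  [hopf : HopfAlgebra K H]
  [cocomm : Coalgebra.IsCocomm K H]
  /-- The action `h · x = act h x` of the `K`-algebra `H` on the `K`-vector space `L`. -/
  act : H →ₐ[K] Module.End K L
  /-- `h · (x y) = ∑ (h₁ · x) (h₂ · y)`, where `Δ h = ∑ h₁ ⊗ h₂`. -/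
  act_mul : ∀ (h : H) (x y : L),
    act h (x * y) =
      LinearMap.mul' K L
        (TensorProduct.map (act.toLinearMap.flip x) (act.toLinearMap.flip y)
          (Coalgebra.comul (R := K) h))
  /-- `h · k = ε(h) k`. -/
  act_algebraMap : ∀ (h : H) (k : K),
    act h (algebraMap K L k) = algebraMap K L (Coalgebra.counit (R := K) h * k)
  bijective_theta : Function.Bijective (hopfGaloisTheta act)

attribute [instance] HopfGaloisStructure.ring HopfGaloisStructure.hopf HopfGaloisStructure.cocomm

/-- Two Hopf-Galois structures on `L/K` are identified when there is an isomorphism of `K`-Hopf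
algebras compatible with the actions on `L`. (An isomorphism of bialgebras between Hopf algebras
automatically respects antipodes.) -/
def HopfGaloisStructure.setoid : Setoid (HopfGaloisStructure K L) where
  r A B := ∃ f : A.H ≃ₐc[K] B.H, ∀ (h : A.H) (x : L), B.act (f h) x = A.act h x
  iseqv :=
    { refl := fun A => ⟨BialgEquiv.refl K A.H, fun _ _ => rfl⟩
      symm := by
        rintro A B ⟨f, hf⟩
        refine ⟨f.symm, fun h x => ?_⟩
        rw [← hf (f.symm h) x, BialgEquiv.apply_symm_apply]
      trans := by
        rintro A B C ⟨f, hf⟩ ⟨g, hg⟩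
        exact ⟨f.trans g, fun h x => (hg (f h) x).trans (hf h x)⟩ }

/-- The set of Hopf-Galois structures on `L/K`, up to isomorphism. -/
def HopfGaloisClasses : Type (max (u + 1) v) :=
  Quotient (HopfGaloisStructure.setoid K L)

end HopfGalois

/-- `v(p, g)`: the number of distinct prime factors `q` of `g` with `q ≡ 1 (mod p)`. -/
def primeFactorsOneModCount (p g : ℕ) : ℕ :=
  (g.primeFactors.filter (fun q => q ≡ 1 [MOD p])).card

/-- The ordered triples `(d, g, z)` of positive integers with `d * g * z = n` (for `n ≠ 0`). -/
def orderedTripleFactorisations (n : ℕ) : Finset (ℕ × ℕ × ℕ) :=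
  (n.divisors ×ˢ n.divisors ×ˢ n.divisors).filter (fun t => t.1 * t.2.1 * t.2.2 = n)

theorem mem_orderedTripleFactorisations {n : ℕ} (hn : n ≠ 0) (d g z : ℕ) :
    (d, g, z) ∈ orderedTripleFactorisations n ↔ d * g * z = n := by
  simp only [orderedTripleFactorisations, Finset.mem_filter, Finset.mem_product, Nat.mem_divisors]
  refine ⟨fun h => h.2, fun h => ⟨⟨⟨?_, hn⟩, ⟨?_, hn⟩, ⟨?_, hn⟩⟩, h⟩⟩
  · exact ⟨g * z, by rw [← h, mul_assoc]⟩
  · exact ⟨d * z, by rw [← h]; ring⟩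
  · exact ⟨d * g, by rw [← h]; ring⟩

/-! The count passes from Hopf-Galois structures to skew braces, from skew braces to families of
characters, and ends with an exchange of finite sums.

Let `Γ` be the Galois group. The action extends to an isomorphism of `L ⊗ H` with `End_K L`, and by
Dedekind `Γ` is also an `L`-basis of `End_K L`. In `L ⊗ H` the condition `Δ X = X ⊗ X` says that the
endomorphism `X` is multiplicative, so the grouplike elements are exactly those of `Γ`. The
semilinear Galois action on `L ⊗ H` which fixes `H` therefore permutes `Γ`, by `π` say. It respects
the product of `L ⊗ H`, which on `Γ` is `σ ∘ ρ = σ * π σ⁻¹ ρ`. So `Γ` is the multiplicative group of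
a skew brace. Galois descent inverts this: `H` is recovered as the endomorphisms whose coefficients
on `Γ` are equivariant for `π` (`nonempty_hopfGaloisClasses_equiv`).

For `Γ = ∏ ℤ/p_i` with distinct primes, the main point is `IsBraceEquiv.exists_character`: the
coordinate of `a ∘ b` at `p` is `a_p + β(a) b_p` or `β(b)⁻¹ a_p + b_p` for a character `β` with
values in `𝔽_p`. If `p` does not divide the order of the commutator subgroup of the additive group,
that group has essentially one homomorphism to `ℤ/p`, and `β = 1`. Otherwise it has a characteristic
subgroup of order `p`, on which everything acts by scalars, and averaging over the complement of
order prime to `p` kills the remaining cocycle (`map_mul_coordinate`).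

A skew brace is thus a set `S` of primes together with, for each `q ∈ S`, a choice of side and a
nontrivial character to `𝔽_q` trivial on the factors in `S`. That gives `∑_S ∏_{q ∈ S} 2 (∏_{i ∉ S}
N(q,i) - 1)`, where `N(q,i)` counts the characters of `ℤ/p_i` in `𝔽_q`. The identity
`sum_prod_compl_eq` turns it into the sum over factorisations `dgz = n`. -/

/-- An action of a group on its own underlying set which makes it the multiplicative group of a
skew brace, the additive group of which has the operation `a ∘ b = a * π a⁻¹ b`. -/
structure IsBraceAction {Γ : Type*} [Group Γ] (π : Γ → Γ → Γ) : Prop where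
  one_act : ∀ b, π 1 b = b
  mul_act : ∀ a b c, π (a * b) c = π a (π b c)
  act_one : ∀ a, π a 1 = 1
  compat : ∀ a b c, π a (b * π b⁻¹ c) = π a b * π (π a b)⁻¹ (π a c)

/-! ### The Galois group as a basis of `End_K L` -/

section GaloisBasis

variable (K : Type u) (L : Type v) [Field K] [Field L] [Algebra K L]

theorem linearIndependent_galToLinearMap :
    LinearIndependent L (fun σ : L ≃ₐ[K] L => (σ.toLinearMap : L →ₗ[K] L)) :=
  (linearIndependent_algHom_toLinearMap K L L).comp (fun σ : L ≃ₐ[K] L => (σ : L →ₐ[K] L))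
    AlgEquiv.coe_toAlgHom_injective

variable [FiniteDimensional K L] [IsGalois K L]

/-- The elements of the Galois group form an `L`-basis of `End_K L`. -/
noncomputable def endGalBasis : Module.Basis (L ≃ₐ[K] L) L (L →ₗ[K] L) :=
  basisOfLinearIndependentOfCardEqFinrank (linearIndependent_galToLinearMap K L) (by
    rw [Module.finrank_linearMap_self, ← IsGalois.card_aut_eq_finrank, Nat.card_eq_fintype_card])

theorem endGalBasis_apply (σ : L ≃ₐ[K] L) : endGalBasis K L σ = σ.toLinearMap := by
  simp [endGalBasis]

end GaloisBasis

/-! ### The isomorphism of `L ⊗ H` with `End_K L` -/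

namespace HopfGaloisStructure

variable {K : Type u} {L : Type v} [Field K] [Field L] [Algebra K L]

/-- Surjectivity of `θ` makes every `f` a sum of maps `h ↦ x * (h · y)`, and evaluating the given
relation at `y` settles each of these. This is the injectivity of `L ⊗ H → End_K L` in a form that
can be tested against functionals. -/
theorem sum_smul_act_eq_zero (A : HopfGaloisStructure K L) {ι : Type*} (s : Finset ι)
    (l : ι → L) (h : ι → A.H) (h0 : ∑ i ∈ s, l i • (A.act (h i) : L →ₗ[K] L) = 0)
    (f : A.H →ₗ[K] L) : ∑ i ∈ s, l i * f (h i) = 0 := by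
  obtain ⟨t, rfl⟩ := A.bijective_theta.2 f
  induction t with
  | zero => simp
  | tmul x y =>
    have := LinearMap.congr_fun h0 y
    simp only [LinearMap.sum_apply, LinearMap.smul_apply, smul_eq_mul, LinearMap.zero_apply] at this
    simp only [hopfGaloisTheta_tmul]
    rw [← mul_zero x, ← this, Finset.mul_sum]
    exact Finset.sum_congr rfl fun i _ => by ring
  | add x y hx hy =>
    simp only [map_add, LinearMap.add_apply, mul_add, Finset.sum_add_distrib, hx, hy, add_zero]

variable [FiniteDimensional K L] (A : HopfGaloisStructure K L)

instance finite_H : Module.Finite K A.H := by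
  rw [← Module.finite_dual_iff]
  have e : (L ⊗[K] L) ≃ₗ[K] (A.H →ₗ[K] L) := LinearEquiv.ofBijective _ A.bijective_theta
  have : Module.Finite K (A.H →ₗ[K] L) := Module.Finite.equiv e
  refine Module.Finite.of_injective
    (LinearMap.compRight K (Algebra.linearMap K L) : Module.Dual K A.H →ₗ[K] (A.H →ₗ[K] L)) ?_
  intro f g hfg
  ext h
  exact (algebraMap K L).injective (LinearMap.congr_fun hfg h)

theorem finrank_H : Module.finrank K A.H = Module.finrank K L := by
  have e : (L ⊗[K] L) ≃ₗ[K] (A.H →ₗ[K] L) := LinearEquiv.ofBijective _ A.bijective_theta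
  have := e.finrank_eq
  rw [Module.finrank_tensorProduct, Module.finrank_linearMap] at this
  exact (Nat.eq_of_mul_eq_mul_right Module.finrank_pos this).symm

omit [FiniteDimensional K L] in
theorem linearIndependent_act {ι : Type*} {b : ι → A.H} (hb : LinearIndependent K b) :
    LinearIndependent L (fun i => (A.act (b i) : L →ₗ[K] L)) := by
  classical
  rw [linearIndependent_iff']
  intro s l h0 i hi
  let B := Module.Basis.extend hb.linearIndepOn_id
  have hinj := hb.injective
  have key := A.sum_smul_act_eq_zero s l b h0
    (Algebra.linearMap K L ∘ₗ B.coord ⟨b i, Module.Basis.subset_extend _ ⟨i, rfl⟩⟩)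
  rw [Finset.sum_eq_single i] at key
  · have : B.repr (b i) = Finsupp.single ⟨b i, Module.Basis.subset_extend _ ⟨i, rfl⟩⟩ 1 := by
      rw [← B.repr_self]; simp [B]
    simpa [this] using key
  · intro j _ hj
    have : B.repr (b j) = Finsupp.single ⟨b j, Module.Basis.subset_extend _ ⟨j, rfl⟩⟩ 1 := by
      rw [← B.repr_self]; simp [B]
    simp [this, hinj.ne hj]
  · exact fun h => absurd hi h

/-- The index type of a `K`-basis of `H`. -/
abbrev Idx := Module.Free.ChooseBasisIndex K A.H

/-- A `K`-basis of `H`. -/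
noncomputable abbrev basisH : Module.Basis A.Idx K A.H := Module.Free.chooseBasis K A.H

/-- A `K`-basis of `H` acts by an `L`-basis of `End_K L`. -/
noncomputable def endBasis : Module.Basis A.Idx L (L →ₗ[K] L) :=
  basisOfLinearIndependentOfCardEqFinrank' _ (A.linearIndependent_act A.basisH.linearIndependent) (by
    rw [Module.finrank_linearMap_self, ← A.finrank_H, Module.finrank_eq_card_chooseBasisIndex])

theorem endBasis_apply (i : A.Idx) : A.endBasis i = A.act (A.basisH i) := by
  simp [endBasis]

omit [FiniteDimensional K L] in
theorem act_injective : Function.Injective A.act := by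
  rw [injective_iff_map_eq_zero]
  intro h h0
  rw [← Module.forall_dual_apply_eq_zero_iff K]
  intro φ
  have := A.sum_smul_act_eq_zero {()} (fun _ => 1) (fun _ => h) (by simpa using h0)
    (Algebra.linearMap K L ∘ₗ φ)
  simpa using this

theorem endBasis_repr_act (h : A.H) (i : A.Idx) :
    A.endBasis.repr (A.act h) i = algebraMap K L (A.basisH.repr h i) := by
  have key : (A.act h : L →ₗ[K] L) =
      ∑ j, algebraMap K L (A.basisH.repr h j) • A.endBasis j := by
    conv_lhs => rw [← A.basisH.sum_repr h]
    simp only [map_sum, map_smul, endBasis_apply, algebraMap_smul]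
  rw [key, A.endBasis.repr_sum_self]

end HopfGaloisStructure

/-! ### The Galois group as grouplike elements of `L ⊗ H` -/

namespace HopfGaloisStructure

variable {K : Type u} {L : Type v} [Field K] [Field L] [Algebra K L]
variable [FiniteDimensional K L] (A : HopfGaloisStructure K L)

/-- The `τ`-semilinear map on `End_K L = L ⊗ H` which fixes `H`. -/
noncomputable def twist (τ : L ≃ₐ[K] L) (X : L →ₗ[K] L) : L →ₗ[K] L :=
  ∑ i, τ (A.endBasis.repr X i) • A.endBasis i

theorem repr_twist (τ : L ≃ₐ[K] L) (X : L →ₗ[K] L) (i : A.Idx) :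
    A.endBasis.repr (A.twist τ X) i = τ (A.endBasis.repr X i) := by
  rw [twist, A.endBasis.repr_sum_self]

theorem twist_ext {X Y : L →ₗ[K] L} (h : ∀ i, A.endBasis.repr X i = A.endBasis.repr Y i) :
    X = Y :=
  A.endBasis.repr.injective (Finsupp.ext h)

theorem twist_one (X : L →ₗ[K] L) : A.twist 1 X = X :=
  A.twist_ext fun i => by rw [repr_twist]; rfl

theorem twist_mul (σ τ : L ≃ₐ[K] L) (X : L →ₗ[K] L) :
    A.twist (σ * τ) X = A.twist σ (A.twist τ X) :=
  A.twist_ext fun i => by simp only [repr_twist]; rfl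

theorem twist_zero (τ : L ≃ₐ[K] L) : A.twist τ 0 = 0 :=
  A.twist_ext fun i => by simp [repr_twist]

theorem twist_add (τ : L ≃ₐ[K] L) (X Y : L →ₗ[K] L) :
    A.twist τ (X + Y) = A.twist τ X + A.twist τ Y :=
  A.twist_ext fun i => by simp [repr_twist]

theorem twist_smul (τ : L ≃ₐ[K] L) (l : L) (X : L →ₗ[K] L) :
    A.twist τ (l • X) = τ l • A.twist τ X :=
  A.twist_ext fun i => by simp [repr_twist]

theorem twist_sum {ι : Type*} (s : Finset ι) (τ : L ≃ₐ[K] L) (X : ι → (L →ₗ[K] L)) :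
    A.twist τ (∑ i ∈ s, X i) = ∑ i ∈ s, A.twist τ (X i) :=
  map_sum (⟨⟨A.twist τ, A.twist_zero τ⟩, A.twist_add τ⟩ : (L →ₗ[K] L) →+ (L →ₗ[K] L)) X s

theorem twist_act (τ : L ≃ₐ[K] L) (h : A.H) : A.twist τ (A.act h) = A.act h :=
  A.twist_ext fun i => by simp [repr_twist, endBasis_repr_act]

theorem mem_range_act_iff [IsGalois K L] (X : L →ₗ[K] L) :
    (∃ h, A.act h = X) ↔ ∀ τ, A.twist τ X = X := by
  constructor
  · rintro ⟨h, rfl⟩ τ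
    exact A.twist_act τ h
  · intro hX
    have hfix : ∀ i, ∃ k, algebraMap K L k = A.endBasis.repr X i := fun i => by
      have := (IsGalois.mem_range_algebraMap_iff_fixed (F := K) (A.endBasis.repr X i)).2
        fun τ => by rw [← repr_twist, hX τ]
      exact this
    choose k hk using hfix
    refine ⟨∑ i, k i • A.basisH i, ?_⟩
    rw [← A.endBasis.sum_repr X]
    simp only [map_sum, map_smul, ← endBasis_apply, ← hk, algebraMap_smul]

/-- The structure constants of the comultiplication. -/
noncomputable def comulCoeff (h : A.H) (p : A.Idx × A.Idx) : K :=
  (A.basisH.tensorProduct A.basisH).repr (Coalgebra.comul (R := K) h) p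

theorem act_mul_eq_sum (h : A.H) (x y : L) :
    A.act h (x * y) = ∑ p, algebraMap K L (A.comulCoeff h p) *
      (A.endBasis p.1 x * A.endBasis p.2 y) := by
  rw [A.act_mul]
  conv_lhs => rw [← (A.basisH.tensorProduct A.basisH).sum_repr (Coalgebra.comul (R := K) h)]
  simp only [map_sum, map_smul, Module.Basis.tensorProduct_apply', TensorProduct.map_tmul,
    LinearMap.mul'_apply, LinearMap.flip_apply, AlgHom.toLinearMap_apply, endBasis_apply]
  exact Finset.sum_congr rfl fun p _ => Algebra.smul_def _ _

/-- Linear independence of `endBasis` is used twice, once in each variable. It makes `L ⊗ H ⊗ H`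
embed in the bilinear maps on `L`, so identities in `H ⊗ H` can be checked on pairs of elements of
`L`. -/
theorem eq_zero_of_sum_endBasis_mul (c : A.Idx × A.Idx → L)
    (h : ∀ x y, ∑ p, c p * (A.endBasis p.1 x * A.endBasis p.2 y) = 0) : c = 0 := by
  have h1 : ∀ i x, ∑ j, c (i, j) * A.endBasis j x = 0 := by
    intro i y
    have : ∑ i, (∑ j, c (i, j) * A.endBasis j y) • A.endBasis i = 0 := by
      ext x
      rw [LinearMap.zero_apply, ← h x y, Fintype.sum_prod_type, LinearMap.sum_apply]
      refine Finset.sum_congr rfl fun i _ => ?_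
      rw [LinearMap.smul_apply, smul_eq_mul, Finset.sum_mul]
      exact Finset.sum_congr rfl fun j _ => by ring
    exact Fintype.linearIndependent_iff.1 A.endBasis.linearIndependent _ this i
  ext ⟨i, j⟩
  refine Fintype.linearIndependent_iff.1 A.endBasis.linearIndependent (fun j => c (i, j)) ?_ j
  ext x
  simpa using h1 i x

/-- The right side is `Δ X = X ⊗ X` in coordinates: multiplicative endomorphisms are the solutions
of equations with coefficients in `K`. -/
theorem map_mul_iff (X : L →ₗ[K] L) :
    (∀ x y, X (x * y) = X x * X y) ↔
      ∀ p : A.Idx × A.Idx, ∑ i, A.endBasis.repr X i * algebraMap K L (A.comulCoeff (A.basisH i) p) =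
        A.endBasis.repr X p.1 * A.endBasis.repr X p.2 := by
  have e1 : ∀ x, X x = ∑ i, A.endBasis.repr X i * A.endBasis i x := fun x => by
    have := LinearMap.congr_fun (A.endBasis.sum_repr X) x
    rw [LinearMap.sum_apply] at this
    exact this.symm
  have e2 : ∀ x y, X (x * y) = ∑ p : A.Idx × A.Idx,
      (∑ i, A.endBasis.repr X i * algebraMap K L (A.comulCoeff (A.basisH i) p)) *
        (A.endBasis p.1 x * A.endBasis p.2 y) := fun x y => by
    rw [e1]
    simp only [endBasis_apply A, A.act_mul_eq_sum, Finset.mul_sum, Finset.sum_mul]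
    rw [Finset.sum_comm]
    exact Finset.sum_congr rfl fun p _ => Finset.sum_congr rfl fun i _ => by ring
  have e3 : ∀ x y, X x * X y = ∑ p : A.Idx × A.Idx,
      (A.endBasis.repr X p.1 * A.endBasis.repr X p.2) *
        (A.endBasis p.1 x * A.endBasis p.2 y) := fun x y => by
    rw [e1 x, e1 y, Fintype.sum_mul_sum, Fintype.sum_prod_type]
    exact Finset.sum_congr rfl fun i _ => Finset.sum_congr rfl fun j _ => by ring
  constructor
  · intro h
    have := A.eq_zero_of_sum_endBasis_mul (fun p =>
      ∑ i, A.endBasis.repr X i * algebraMap K L (A.comulCoeff (A.basisH i) p) -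
        A.endBasis.repr X p.1 * A.endBasis.repr X p.2) fun x y => by
      simp only [sub_mul, Finset.sum_sub_distrib]
      rw [← e2, ← e3, h, sub_self]
    exact fun p => sub_eq_zero.1 (congrFun this p)
  · intro h x y
    rw [e2, e3]
    simp only [h]

/-- The grouplike equations have coefficients in `K`, so `τ` carries solutions to solutions. -/
theorem twist_map_mul {X : L →ₗ[K] L} (hX : ∀ x y, X (x * y) = X x * X y) (τ : L ≃ₐ[K] L)
    (x y : L) : A.twist τ X (x * y) = A.twist τ X x * A.twist τ X y := by
  refine (A.map_mul_iff _).2 (fun p => ?_) x y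
  simp only [repr_twist]
  rw [← map_mul τ, ← (A.map_mul_iff X).1 hX, map_sum]
  simp

theorem exists_twist_eq (τ σ : L ≃ₐ[K] L) :
    ∃ ρ : L ≃ₐ[K] L, ρ.toLinearMap = A.twist τ σ.toLinearMap := by
  set V := A.twist τ σ.toLinearMap with hV
  have hmul : ∀ x y, V (x * y) = V x * V y := A.twist_map_mul (by simp) τ
  have hne : V ≠ 0 := fun h0 => by
    have h1 : A.twist τ⁻¹ V = σ.toLinearMap := by rw [hV, ← twist_mul, inv_mul_cancel, twist_one]
    rw [h0, twist_zero] at h1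
    simpa using LinearMap.congr_fun h1 1
  have hone : V 1 = 1 := by
    have h1 := hmul 1 1
    rw [mul_one] at h1
    rcases eq_or_ne (V 1) 0 with h | h
    · refine absurd (LinearMap.ext fun x => ?_) hne
      rw [← mul_one x, hmul, h, mul_zero, LinearMap.zero_apply]
    · exact (mul_eq_left₀ h).1 h1.symm
  let f : L →ₐ[K] L := AlgHom.ofLinearMap V hone hmul
  exact ⟨AlgEquiv.ofBijective f f.bijective, rfl⟩

/-- The permutation action of the Galois group on itself determined by a Hopf-Galois structure. -/
noncomputable def galAct (τ σ : L ≃ₐ[K] L) : L ≃ₐ[K] L := (A.exists_twist_eq τ σ).choose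

theorem galAct_toLinearMap (τ σ : L ≃ₐ[K] L) :
    (A.galAct τ σ).toLinearMap = A.twist τ σ.toLinearMap := (A.exists_twist_eq τ σ).choose_spec

/-- The `L`-bilinear extension to `End_K L = L ⊗ H` of the multiplication of `H`. -/
noncomputable def star (X Y : L →ₗ[K] L) : L →ₗ[K] L :=
  ∑ i, A.endBasis.repr Y i • (X ∘ₗ A.endBasis i)

theorem twist_comp_endBasis (τ : L ≃ₐ[K] L) (X : L →ₗ[K] L) (i : A.Idx) :
    A.twist τ (X ∘ₗ A.endBasis i) = A.twist τ X ∘ₗ A.endBasis i := by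
  have hsum : ∀ c : A.Idx → L, (∑ j, c j • A.endBasis j) ∘ₗ A.endBasis i =
      ∑ j, c j • (A.endBasis j ∘ₗ A.endBasis i) := fun c => by
    ext x
    simp only [LinearMap.comp_apply, LinearMap.sum_apply, LinearMap.smul_apply]
  conv_lhs => rw [← A.endBasis.sum_repr X]
  rw [hsum, twist_sum, show A.twist τ X = ∑ j, τ (A.endBasis.repr X j) • A.endBasis j from rfl, hsum]
  simp only [twist_smul]
  refine Finset.sum_congr rfl fun j _ => ?_
  rw [endBasis_apply, endBasis_apply, ← Module.End.mul_eq_comp, ← map_mul, twist_act]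

theorem twist_star (τ : L ≃ₐ[K] L) (X Y : L →ₗ[K] L) :
    A.twist τ (A.star X Y) = A.star (A.twist τ X) (A.twist τ Y) := by
  simp only [star, twist_sum, twist_smul, twist_comp_endBasis, repr_twist]

/-- Moving `σ` past the coefficients of `Y` untwists them. For `Y` in `Γ` this shows that the
product of grouplike elements in `L ⊗ H` is `σ * galAct σ⁻¹ ρ`. -/
theorem star_toLinearMap (σ : L ≃ₐ[K] L) (Y : L →ₗ[K] L) :
    A.star σ.toLinearMap Y = σ.toLinearMap ∘ₗ A.twist σ⁻¹ Y := by
  ext x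
  simp only [star, twist, LinearMap.sum_apply, LinearMap.smul_apply, LinearMap.comp_apply,
    AlgEquiv.toLinearMap_apply, map_sum, smul_eq_mul, map_mul]
  refine Finset.sum_congr rfl fun i _ => ?_
  rw [← AlgEquiv.mul_apply, mul_inv_cancel, AlgEquiv.one_apply]

theorem isBraceAction_galAct : IsBraceAction A.galAct where
  one_act b := AlgEquiv.toLinearMap_injective (by rw [galAct_toLinearMap, twist_one])
  mul_act a b c := AlgEquiv.toLinearMap_injective (by simp only [galAct_toLinearMap, twist_mul])
  act_one a := AlgEquiv.toLinearMap_injective (by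
    rw [galAct_toLinearMap]
    have : (1 : L ≃ₐ[K] L).toLinearMap = A.act 1 := by rw [map_one]; rfl
    rw [this, twist_act])
  compat a b c := AlgEquiv.toLinearMap_injective (by
    have h : ∀ σ ρ : L ≃ₐ[K] L, (σ * A.galAct σ⁻¹ ρ).toLinearMap =
        A.star σ.toLinearMap ρ.toLinearMap := fun σ ρ => by
      rw [star_toLinearMap, ← galAct_toLinearMap]; rfl
    rw [galAct_toLinearMap, h, h, twist_star, ← galAct_toLinearMap, ← galAct_toLinearMap])

end HopfGaloisStructure

/-! ### Recovering `H` from the permutation action -/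

section EquivariantEnd

variable {K : Type u} {L : Type v} [Field K] [Field L] [Algebra K L]
variable [FiniteDimensional K L] [IsGalois K L]

/-- The endomorphisms `∑ a σ • σ` of `L` with `a (π τ σ) = τ (a σ)`. -/
def equivariantEnd (π : (L ≃ₐ[K] L) → (L ≃ₐ[K] L) → (L ≃ₐ[K] L)) : Submodule K (L →ₗ[K] L) where
  carrier := {X | ∀ τ σ, (endGalBasis K L).repr X (π τ σ) = τ ((endGalBasis K L).repr X σ)}
  add_mem' := fun {X Y} hX hY τ σ => by simp [hX τ σ, hY τ σ]
  zero_mem' := fun τ σ => by simp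
  smul_mem' := fun k X hX τ σ => by
    rw [← algebraMap_smul L, map_smul]
    simp [hX τ σ]

theorem mem_equivariantEnd {π : (L ≃ₐ[K] L) → (L ≃ₐ[K] L) → (L ≃ₐ[K] L)} {X : L →ₗ[K] L} :
    X ∈ equivariantEnd π ↔
      ∀ τ σ, (endGalBasis K L).repr X (π τ σ) = τ ((endGalBasis K L).repr X σ) := Iff.rfl

namespace HopfGaloisStructure

variable (A : HopfGaloisStructure K L)

omit [IsGalois K L] in
theorem galAct_injective (τ : L ≃ₐ[K] L) : Function.Injective (A.galAct τ) := by
  intro σ ρ h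
  rw [← A.isBraceAction_galAct.one_act σ, ← A.isBraceAction_galAct.one_act ρ, ← inv_mul_cancel τ,
    A.isBraceAction_galAct.mul_act, A.isBraceAction_galAct.mul_act, h]

theorem repr_twist_galAct (τ σ : L ≃ₐ[K] L) (X : L →ₗ[K] L) :
    (endGalBasis K L).repr (A.twist τ X) (A.galAct τ σ) = τ ((endGalBasis K L).repr X σ) := by
  classical
  conv_lhs => rw [← (endGalBasis K L).sum_repr X]
  simp only [twist_sum, twist_smul, endGalBasis_apply, ← galAct_toLinearMap]
  simp only [← endGalBasis_apply, map_sum, map_smul, Module.Basis.repr_self]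
  rw [Finsupp.finsetSum_apply, Finset.sum_eq_single σ]
  · simp
  · intro ρ _ h
    simp [(A.galAct_injective τ).ne h]
  · simp

/-- Equivariance of the coefficients of `X` on `Γ` is invariance of `X` under every `twist τ`, and
by Galois descent the invariants of `L ⊗ H` are `H`. Hence `galAct` determines the image of `H`. -/
theorem mem_equivariantEnd_galAct (X : L →ₗ[K] L) :
    X ∈ equivariantEnd A.galAct ↔ ∃ h, A.act h = X := by
  rw [mem_range_act_iff, mem_equivariantEnd]
  refine forall_congr' fun τ => ⟨fun h => (endGalBasis K L).repr.injective (Finsupp.ext fun σ => ?_),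
    fun h σ => ?_⟩
  · obtain ⟨ρ, rfl⟩ := Finite.surjective_of_injective (A.galAct_injective τ) σ
    rw [repr_twist_galAct, h]
  · conv_lhs => rw [← h]
    rw [repr_twist_galAct]

end HopfGaloisStructure
end EquivariantEnd

/-! ### Tensors as functions -/

section MulFun

variable {K : Type u} {L : Type v} [Field K] [Field L] [Algebra K L]
variable {M N : Type*} [AddCommMonoid M] [Module K M] [AddCommMonoid N] [Module K N]
variable {X Y : Type*}

/-- The map `M ⊗ N → L^(X × Y)` induced by `φ : M → L^X` and `ψ : N → L^Y`. -/
noncomputable def mulFun (φ : M →ₗ[K] X → L) (ψ : N →ₗ[K] Y → L) : M ⊗[K] N →ₗ[K] X × Y → L :=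
  TensorProduct.lift (LinearMap.mk₂ K (fun m n p => φ m p.1 * ψ n p.2)
    (fun _ _ _ => by ext; simp [add_mul]) (fun _ _ _ => by ext; simp)
    (fun _ _ _ => by ext; simp [mul_add]) (fun _ _ _ => by ext; simp))

@[simp] theorem mulFun_tmul (φ : M →ₗ[K] X → L) (ψ : N →ₗ[K] Y → L) (m : M) (n : N) (p : X × Y) :
    mulFun φ ψ (m ⊗ₜ n) p = φ m p.1 * ψ n p.2 := by
  simp [mulFun]

theorem linearIndependent_mul {ι κ : Type*} [Fintype ι] [Fintype κ] {b : ι → X → L}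
    {c : κ → Y → L} (hb : LinearIndependent L b) (hc : LinearIndependent L c) :
    LinearIndependent L (fun (i : ι × κ) (p : X × Y) => b i.1 p.1 * c i.2 p.2) := by
  rw [Fintype.linearIndependent_iff] at *
  rintro l hl ⟨i, j⟩
  refine hc (fun j => l (i, j)) (funext fun y => ?_) j
  rw [Finset.sum_apply]
  refine hb (fun i => ∑ j, (l (i, j) • c j) y) (funext fun x => ?_) i
  have := congrFun hl (x, y)
  rw [Finset.sum_apply, Fintype.sum_prod_type] at this
  rw [Finset.sum_apply, Pi.zero_apply, ← (this.trans rfl : _ = (0 : L))]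
  refine Finset.sum_congr rfl fun i _ => ?_
  simp only [Pi.smul_apply, smul_eq_mul, Finset.sum_mul]
  exact Finset.sum_congr rfl fun j _ => by ring

/-- A linear map `M → L^X` whose `L`-linear extension `L ⊗ M → L^X` is injective. -/
def SepMap (φ : M →ₗ[K] X → L) : Prop :=
  ∃ (n : ℕ) (b : Module.Basis (Fin n) K M), LinearIndependent L (fun i => φ (b i))

theorem SepMap.of_basis {φ : M →ₗ[K] X → L} {ι : Type*} [Fintype ι] (b : Module.Basis ι K M)
    (h : LinearIndependent L (fun i => φ (b i))) : SepMap φ := by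
  refine ⟨Fintype.card ι, b.reindex (Fintype.equivFin ι), ?_⟩
  have : (fun i => φ ((b.reindex (Fintype.equivFin ι)) i)) =
      (fun i => φ (b i)) ∘ (Fintype.equivFin ι).symm :=
    funext fun i => congrArg φ (b.reindex_apply _ i)
  rw [this]
  exact h.comp _ (Fintype.equivFin ι).symm.injective

theorem SepMap.injective {φ : M →ₗ[K] X → L} (h : SepMap φ) : Function.Injective φ := by
  obtain ⟨n, b, hb⟩ := h
  intro m m' hm
  rw [← b.sum_repr m, ← b.sum_repr m', map_sum, map_sum, ← sub_eq_zero,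
    ← Finset.sum_sub_distrib] at hm
  have := Fintype.linearIndependent_iff.1 hb
    (fun i => algebraMap K L (b.repr m i - b.repr m' i)) (by
      simpa only [map_smul, algebraMap_smul, sub_smul] using hm)
  refine b.repr.injective (Finsupp.ext fun i => ?_)
  simpa [sub_eq_zero] using this i

theorem SepMap.mulFun {φ : M →ₗ[K] X → L} {ψ : N →ₗ[K] Y → L} (hφ : SepMap φ) (hψ : SepMap ψ) :
    SepMap (mulFun φ ψ) := by
  obtain ⟨n, b, hb⟩ := hφ
  obtain ⟨m, c, hc⟩ := hψ
  refine .of_basis (b.tensorProduct c) ?_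
  convert linearIndependent_mul hb hc using 1
  funext i p
  simp [Module.Basis.tensorProduct_apply']

end MulFun

/-! ### Galois descent for functions on a set with Galois action -/

section Descent

variable {K : Type u} {L : Type v} [Field K] [Field L] [Algebra K L]
variable {X : Type*} (p : (L ≃ₐ[K] L) → X → X)

/-- The functions `f : X → L` with `f (τ x) = τ (f x)`. -/
def IsEquivariant (f : X → L) : Prop := ∀ τ x, f (p τ x) = τ (f x)

variable {p}

/-- Conjugating `f` by `τ` applies `τ` to its coordinates in an equivariant basis and leaves `f`
unchanged, so the coordinates are fixed by the Galois group. -/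
theorem IsEquivariant.descent [FiniteDimensional K L] [IsGalois K L]
    (h1 : ∀ x, p 1 x = x) (hmul : ∀ σ τ x, p (σ * τ) x = p σ (p τ x))
    {ι : Type*} [Fintype ι] (b : Module.Basis ι L (X → L)) (hb : ∀ i, IsEquivariant p (b i))
    {f : X → L} (hf : IsEquivariant p f) :
    ∃ k : ι → K, f = ∑ i, algebraMap K L (k i) • b i := by
  have hfix : ∀ i, ∃ k, algebraMap K L k = b.repr f i := fun i => by
    refine (IsGalois.mem_range_algebraMap_iff_fixed (F := K) (b.repr f i)).2 fun τ => ?_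
    have : f = ∑ i, τ (b.repr f i) • b i := by
      ext x
      obtain ⟨y, rfl⟩ : ∃ y, p τ y = x := ⟨p τ⁻¹ x, by rw [← hmul, mul_inv_cancel, h1]⟩
      rw [hf τ y]
      conv_lhs => rw [← b.sum_repr f]
      simp only [Finset.sum_apply, Pi.smul_apply, smul_eq_mul, map_sum, map_mul, hb _ τ y]
    conv_rhs => rw [this]
    rw [b.repr_sum_self]
  choose k hk using hfix
  exact ⟨k, by simp only [hk, b.sum_repr]⟩

/-- A functional vanishing on equivariant functions vanishes on the trace `∑ τ, τ l` placed at `p τ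
x`, for every `l`. Dedekind independence then makes its value at each delta function zero. -/
theorem IsEquivariant.span_eq_top [FiniteDimensional K L] [Finite X]
    (h1 : ∀ x, p 1 x = x) (hmul : ∀ σ τ x, p (σ * τ) x = p σ (p τ x)) :
    Submodule.span L {f : X → L | IsEquivariant p f} = ⊤ := by
  classical
  have := Fintype.ofFinite X
  by_contra hne
  obtain ⟨ℓ, hℓ, hle⟩ := Submodule.exists_le_ker_of_lt_top _ (lt_top_iff_ne_top.2 hne)
  refine hℓ (LinearMap.pi_ext' fun x => LinearMap.ext_ring ?_)
  have hsum : ∀ f : X → L, ℓ f = ∑ y, f y * ℓ (Pi.single y 1) := fun f => by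
    conv_lhs => rw [pi_eq_sum_univ' f, map_sum]
    refine Finset.sum_congr rfl fun y _ => ?_
    rw [map_smul, smul_eq_mul]
  have key : ∀ l : L, ∑ τ : L ≃ₐ[K] L, ℓ (Pi.single (p τ x) 1) * τ l = 0 := fun l => by
    have hmem : IsEquivariant p (fun y => ∑ τ : L ≃ₐ[K] L, if p τ x = y then τ l else 0) := by
      intro ρ y
      rw [map_sum]
      refine Fintype.sum_equiv (Equiv.mulLeft ρ⁻¹) _ _ fun τ => ?_
      have : p (ρ⁻¹ * τ) x = y ↔ p τ x = p ρ y := by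
        constructor
        · rintro rfl
          rw [← hmul, mul_inv_cancel_left]
        · intro h
          rw [hmul, h, ← hmul, inv_mul_cancel, h1]
      simp only [Equiv.coe_mulLeft, this]
      split_ifs
      · rw [← AlgEquiv.mul_apply, mul_inv_cancel_left]
      · simp
    have h0 : ℓ _ = 0 := hle (Submodule.subset_span (Set.mem_ofPred.2 hmem))
    rw [hsum] at h0
    simp only [Finset.sum_mul] at h0
    rw [Finset.sum_comm] at h0
    rw [← h0]
    refine Finset.sum_congr rfl fun τ _ => ?_
    rw [Finset.sum_eq_single (p τ x)]
    · simp [mul_comm]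
    · intro y _ hy
      simp [hy.symm]
    · simp
  have := Fintype.linearIndependent_iff.1 (linearIndependent_galToLinearMap K L)
    (fun τ => ℓ (Pi.single (p τ x) 1)) (LinearMap.ext fun l => by
      simpa [LinearMap.sum_apply] using key l) 1
  simpa [h1] using this

theorem IsEquivariant.exists_basis [FiniteDimensional K L] [Finite X]
    (h1 : ∀ x, p 1 x = x) (hmul : ∀ σ τ x, p (σ * τ) x = p σ (p τ x)) :
    ∃ b : Module.Basis X L (X → L), ∀ i, IsEquivariant p (b i) := by
  have := Fintype.ofFinite X
  let B := Module.Basis.ofSpan (IsEquivariant.span_eq_top h1 hmul).ge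
  have hB : ∀ i, IsEquivariant p (B i) := fun i =>
    Module.Basis.ofSpan_subset (IsEquivariant.span_eq_top h1 hmul).ge ⟨i, rfl⟩
  refine ⟨B.reindex (B.indexEquiv (Pi.basisFun L X)), fun i => ?_⟩
  rw [Module.Basis.reindex_apply]
  exact hB _

end Descent

/-! ### The additive group of a brace action -/

section BraceGroup

variable {Γ : Type*} [Group Γ] (π : Γ → Γ → Γ)

/-- The additive operation of the skew brace given by a brace action. -/
def braceOp (a b : Γ) : Γ := a * π a⁻¹ b

/-- The inverse for the additive operation of the skew brace given by a brace action. -/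
def braceInv (a : Γ) : Γ := π a a⁻¹

namespace IsBraceAction

variable {π} (hπ : IsBraceAction π)
include hπ

theorem act_inv_act (a b : Γ) : π a (π a⁻¹ b) = b := by
  rw [← hπ.mul_act, mul_inv_cancel, hπ.one_act]

theorem inv_act_act (a b : Γ) : π a⁻¹ (π a b) = b := by
  rw [← hπ.mul_act, inv_mul_cancel, hπ.one_act]

omit hπ in
/-- The permutation of `Γ` by which `a` acts. -/
def equiv (hπ : IsBraceAction π) (a : Γ) : Γ ≃ Γ where
  toFun := π a
  invFun := π a⁻¹
  left_inv := hπ.inv_act_act a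
  right_inv := hπ.act_inv_act a

omit hπ in
@[simp] theorem equiv_apply (hπ : IsBraceAction π) (a b : Γ) : hπ.equiv a b = π a b := rfl

theorem act_injective (a : Γ) : Function.Injective (π a) := (hπ.equiv a).injective

theorem act_eq_one_iff {a b : Γ} : π a b = 1 ↔ b = 1 := by
  conv_lhs => rw [← hπ.act_one a, (hπ.act_injective a).eq_iff]

theorem act_op (a b c : Γ) : π a (braceOp π b c) = braceOp π (π a b) (π a c) := hπ.compat a b c

theorem op_act (a b : Γ) : braceOp π a (π a b) = a * b := by
  rw [braceOp, hπ.inv_act_act]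

theorem op_assoc (a b c : Γ) :
    braceOp π (braceOp π a b) c = braceOp π a (braceOp π b c) := by
  conv_rhs => rw [braceOp, hπ.act_op]
  simp only [braceOp, mul_inv_rev, hπ.mul_act, mul_assoc]

theorem op_one (a : Γ) : braceOp π a 1 = a := by rw [braceOp, hπ.act_one, mul_one]

theorem one_op (a : Γ) : braceOp π 1 a = a := by rw [braceOp, inv_one, hπ.one_act, one_mul]

theorem op_inv (a : Γ) : braceOp π a (braceInv π a) = 1 := by
  rw [braceInv, hπ.op_act, mul_inv_cancel]

theorem inv_inv (a : Γ) : braceInv π (braceInv π a) = a := by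
  rw [← hπ.one_op (braceInv π (braceInv π a)), ← hπ.op_inv a, hπ.op_assoc, hπ.op_inv, hπ.op_one]

theorem inv_op (a : Γ) : braceOp π (braceInv π a) a = 1 := by
  conv_lhs => rw [← hπ.inv_inv a, hπ.inv_inv]
  simpa [hπ.inv_inv] using hπ.op_inv (braceInv π a)

theorem eq_inv_of_op_eq_one {a b : Γ} (h : braceOp π a b = 1) : b = braceInv π a := by
  rw [← hπ.one_op b, ← hπ.inv_op a, hπ.op_assoc, h, hπ.op_one]

theorem act_inv (a b : Γ) : π a (braceInv π b) = braceInv π (π a b) :=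
  hπ.eq_inv_of_op_eq_one (by rw [← hπ.act_op, hπ.op_inv, hπ.act_one])

omit hπ in
/-- The inversion of the additive group as a permutation. -/
def invEquiv (hπ : IsBraceAction π) : Γ ≃ Γ where
  toFun := braceInv π
  invFun := braceInv π
  left_inv := hπ.inv_inv
  right_inv := hπ.inv_inv

omit hπ in
@[simp] theorem invEquiv_apply (hπ : IsBraceAction π) (a : Γ) : hπ.invEquiv a = braceInv π a := rfl

end IsBraceAction
end BraceGroup

/-! ### The Hopf algebra of a brace action -/

section Construction

variable {K : Type u} {L : Type v} [Field K] [Field L] [Algebra K L]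
variable [FiniteDimensional K L] [IsGalois K L]
variable {π : (L ≃ₐ[K] L) → (L ≃ₐ[K] L) → (L ≃ₐ[K] L)}

open Classical in
theorem endGalBasis_repr_sum {ι : Type*} [Fintype ι] (a : ι → L) (f : ι → (L ≃ₐ[K] L))
    (μ : L ≃ₐ[K] L) :
    (endGalBasis K L).repr (∑ i, a i • endGalBasis K L (f i)) μ = ∑ i, if f i = μ then a i else 0 := by
  simp [Finsupp.single_apply]

/-- For `Y = ∑ y_ρ ρ` equivariant, `σ (y_ρ ρ) = y_{π σ ρ} (σ * ρ)`, and `σ * ρ` is the sum of `σ`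
and `π σ ρ` in the additive group. So composition becomes the product of the `L`-group algebra of
the additive group, on which `π` acts by automorphisms. -/
theorem equivariantEnd_comp (hπ : IsBraceAction π) (X : L →ₗ[K] L) {Y : L →ₗ[K] L}
    (hY : Y ∈ equivariantEnd π) :
    X ∘ₗ Y = ∑ p : (L ≃ₐ[K] L) × (L ≃ₐ[K] L),
      ((endGalBasis K L).repr X p.1 * (endGalBasis K L).repr Y p.2) •
        endGalBasis K L (braceOp π p.1 p.2) := by
  ext x
  rw [LinearMap.comp_apply]
  conv_lhs =>
    rw [← (endGalBasis K L).sum_repr X, LinearMap.sum_apply]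
  rw [LinearMap.sum_apply, Fintype.sum_prod_type]
  refine Finset.sum_congr rfl fun σ _ => ?_
  have hYx : Y x = ∑ ρ, (endGalBasis K L).repr Y ρ * ρ x := by
    conv_lhs => rw [← (endGalBasis K L).sum_repr Y, LinearMap.sum_apply]
    simp [endGalBasis_apply]
  rw [LinearMap.smul_apply, hYx, endGalBasis_apply, AlgEquiv.toLinearMap_apply, map_sum,
    smul_eq_mul, Finset.mul_sum]
  refine Fintype.sum_equiv (hπ.equiv σ) _ _ fun ρ => ?_
  rw [hπ.equiv_apply, hY, hπ.op_act, LinearMap.smul_apply, endGalBasis_apply, map_mul,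
    smul_eq_mul, AlgEquiv.toLinearMap_apply, AlgEquiv.mul_apply, mul_assoc]

/-- The `K`-subalgebra of `End_K L` which acts in the Hopf-Galois structure of a brace action. -/
def equivariantSubalgebra (hπ : IsBraceAction π) : Subalgebra K (Module.End K L) where
  __ := equivariantEnd π
  mul_mem' := by
    classical
    intro X Y hX hY τ μ
    rw [Module.End.mul_eq_comp, equivariantEnd_comp hπ X hY, endGalBasis_repr_sum,
      endGalBasis_repr_sum, map_sum]
    symm
    refine Fintype.sum_equiv ((hπ.equiv τ).prodCongr (hπ.equiv τ)) _ _ fun p => ?_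
    simp only [Equiv.prodCongr_apply, Prod.map_fst, Prod.map_snd, hπ.equiv_apply, ← hπ.act_op,
      (hπ.act_injective τ).eq_iff, hX τ p.1, hY τ p.2]
    split_ifs <;> simp
  algebraMap_mem' := by
    classical
    intro k
    rw [Algebra.algebraMap_eq_smul_one]
    refine (equivariantEnd π).smul_mem k fun τ σ => ?_
    have : (1 : Module.End K L) = endGalBasis K L 1 := by rw [endGalBasis_apply]; rfl
    rw [this, Module.Basis.repr_self, Finsupp.single_apply, Finsupp.single_apply]
    simp only [eq_comm (a := (1 : L ≃ₐ[K] L)), hπ.act_eq_one_iff]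
    split_ifs <;> simp

namespace BraceHopf

variable (hπ : IsBraceAction π)

/-- The coefficients of an element with respect to the Galois group. -/
noncomputable def coeff : equivariantSubalgebra hπ →ₗ[K] (L ≃ₐ[K] L) → L where
  toFun h := (endGalBasis K L).repr h.1
  map_add' a b := by ext; simp
  map_smul' k a := by
    have : (k • a).1 = algebraMap K L k • (a.1 : L →ₗ[K] L) := (algebraMap_smul L k a.1).symm
    ext σ
    rw [this, map_smul, Finsupp.smul_apply, algebraMap_smul]
    rfl

theorem coeff_apply (h : equivariantSubalgebra hπ) (σ : L ≃ₐ[K] L) :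
    coeff hπ h σ = (endGalBasis K L).repr h.1 σ := rfl

theorem coeff_act (h : equivariantSubalgebra hπ) : IsEquivariant π (coeff hπ h) := h.2

/-- The underlying functions of endomorphisms. -/
def ev : equivariantSubalgebra hπ →ₗ[K] L → L where
  toFun h := h.1
  map_add' _ _ := rfl
  map_smul' _ _ := rfl

theorem ev_apply (h : equivariantSubalgebra hπ) (x : L) : ev hπ h x = h.1 x := rfl

theorem ev_eq_sum (h : equivariantSubalgebra hπ) (x : L) :
    ev hπ h x = ∑ σ, coeff hπ h σ * σ x := by
  rw [ev_apply]
  conv_lhs => rw [← (endGalBasis K L).sum_repr h.1, LinearMap.sum_apply]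
  simp [endGalBasis_apply, coeff_apply]

theorem exists_coeff_eq {f : (L ≃ₐ[K] L) → L} (hf : IsEquivariant π f) :
    ∃ h, coeff hπ h = f :=
  ⟨⟨(endGalBasis K L).equivFun.symm f, fun τ σ => by
    simpa only [← Module.Basis.equivFun_apply, LinearEquiv.apply_symm_apply] using hf τ σ⟩, by
    ext σ
    rw [coeff_apply, ← Module.Basis.equivFun_apply, LinearEquiv.apply_symm_apply]⟩

theorem coeff_injective : Function.Injective (coeff hπ) := fun _ _ h =>
  Subtype.ext ((endGalBasis K L).repr.injective (DFunLike.coe_injective h))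

theorem exists_basis : ∃ (b : Module.Basis (L ≃ₐ[K] L) L ((L ≃ₐ[K] L) → L))
    (B : Module.Basis (L ≃ₐ[K] L) K (equivariantSubalgebra hπ)), (∀ i, coeff hπ (B i) = b i) := by
  obtain ⟨b, hb⟩ := IsEquivariant.exists_basis hπ.one_act hπ.mul_act
  choose h hh using fun i => exists_coeff_eq hπ (hb i)
  refine ⟨b, Module.Basis.mk (v := h) ?_ ?_, fun i => by rw [Module.Basis.mk_apply, hh]⟩
  · refine LinearIndependent.of_comp (coeff hπ) ?_
    have : coeff hπ ∘ h = b := funext hh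
    rw [this]
    exact b.linearIndependent.restrict_scalars' K
  · intro x _
    obtain ⟨k, hk⟩ := (coeff_act hπ x).descent hπ.one_act hπ.mul_act b hb
    have : x = ∑ i, k i • h i := coeff_injective hπ (by
      rw [hk, map_sum]
      simp only [map_smul, hh, algebraMap_smul])
    rw [this]
    exact Submodule.sum_mem _ fun i _ => Submodule.smul_mem _ _ (Submodule.subset_span ⟨i, rfl⟩)

theorem sepMap_coeff : SepMap (coeff hπ) := by
  obtain ⟨b, B, hB⟩ := exists_basis hπ
  exact .of_basis B (by simpa only [hB] using b.linearIndependent)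

theorem sepMap_ev : SepMap (ev hπ) := by
  obtain ⟨b, B, hB⟩ := exists_basis hπ
  refine .of_basis B ?_
  rw [Fintype.linearIndependent_iff]
  intro g hg
  refine Fintype.linearIndependent_iff.1 b.linearIndependent g ?_
  simp only [← hB]
  have : ∑ i, g i • (B i).1 = (0 : L →ₗ[K] L) := by
    ext x
    rw [LinearMap.sum_apply]
    simpa [ev_apply] using congrFun hg x
  ext σ
  have := congrArg (fun X => (endGalBasis K L).repr X σ) this
  simpa [coeff_apply] using this

theorem finrank_eq : Module.finrank K (equivariantSubalgebra hπ) = Module.finrank K L := by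
  obtain ⟨b, B, hB⟩ := exists_basis hπ
  rw [Module.finrank_eq_card_basis B, ← IsGalois.card_aut_eq_finrank, Nat.card_eq_fintype_card]

instance : Module.Finite K (equivariantSubalgebra hπ) := by
  obtain ⟨b, B, hB⟩ := exists_basis hπ
  exact Module.Finite.of_basis B

theorem mulFun_ev (t : equivariantSubalgebra hπ ⊗[K] equivariantSubalgebra hπ) (x y : L) :
    mulFun (ev hπ) (ev hπ) t (x, y) =
      ∑ p : (L ≃ₐ[K] L) × (L ≃ₐ[K] L), mulFun (coeff hπ) (coeff hπ) t p * (p.1 x * p.2 y) := by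
  induction t with
  | zero => simp
  | add s t hs ht => simp only [map_add, Pi.add_apply, hs, ht, add_mul, Finset.sum_add_distrib]
  | tmul a b =>
    simp only [mulFun_tmul, ev_eq_sum, Fintype.sum_mul_sum, Fintype.sum_prod_type]
    exact Finset.sum_congr rfl fun i _ => Finset.sum_congr rfl fun j _ => by ring

-- The coefficients of `h`, put on the diagonal, are equivariant for the diagonal action on pairs.
-- Products of an equivariant basis form an equivariant basis, so descent yields coefficients in
-- `K`, that is, a tensor over `K`.
open Classical in
theorem exists_comul (h : equivariantSubalgebra hπ) :
    ∃ t, mulFun (coeff hπ) (coeff hπ) t =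
      fun p => if p.1 = p.2 then coeff hπ h p.1 else 0 := by
  obtain ⟨b, B, hB⟩ := exists_basis hπ
  let b2 : Module.Basis ((L ≃ₐ[K] L) × (L ≃ₐ[K] L)) L ((L ≃ₐ[K] L) × (L ≃ₐ[K] L) → L) :=
    basisOfLinearIndependentOfCardEqFinrank
      (linearIndependent_mul b.linearIndependent b.linearIndependent) (by simp)
  have hb2 : ∀ i, b2 i = fun p => b i.1 p.1 * b i.2 p.2 := fun i => by simp [b2]
  have hb : ∀ i, IsEquivariant π (b i) := fun i => by rw [← hB]; exact coeff_act hπ _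
  let p2 : (L ≃ₐ[K] L) → (L ≃ₐ[K] L) × (L ≃ₐ[K] L) → (L ≃ₐ[K] L) × (L ≃ₐ[K] L) :=
    fun τ p => (π τ p.1, π τ p.2)
  have hf : IsEquivariant p2 (fun p => if p.1 = p.2 then coeff hπ h p.1 else 0) := fun τ p => by
    simp only [p2, (hπ.act_injective τ).eq_iff]
    split_ifs
    · exact coeff_act hπ h τ p.1
    · simp
  obtain ⟨k, hk⟩ := hf.descent (fun p => by simp only [p2, hπ.one_act])
    (fun σ τ p => by simp only [p2, hπ.mul_act]) b2 (fun i τ p => by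
      simp only [hb2, p2, hb _ τ, map_mul])
  refine ⟨∑ i, k i • (B i.1 ⊗ₜ B i.2), ?_⟩
  rw [hk, map_sum]
  refine Finset.sum_congr rfl fun i _ => ?_
  ext p
  rw [map_smul, Pi.smul_apply, mulFun_tmul, hB, hB, algebraMap_smul, Pi.smul_apply, hb2]

open Classical in
/-- The comultiplication for which the elements of the Galois group are grouplike. -/
noncomputable def comul :
    equivariantSubalgebra hπ →ₗ[K] equivariantSubalgebra hπ ⊗[K] equivariantSubalgebra hπ where
  toFun h := (exists_comul hπ h).choose
  map_add' a b := ((sepMap_coeff hπ).mulFun (sepMap_coeff hπ)).injective (by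
    rw [(mulFun (coeff hπ) (coeff hπ)).map_add (exists_comul hπ a).choose, (exists_comul hπ (a + b)).choose_spec, (exists_comul hπ a).choose_spec,
      (exists_comul hπ b).choose_spec]
    ext p
    simp only [map_add, Pi.add_apply]
    split_ifs <;> simp)
  map_smul' k a := ((sepMap_coeff hπ).mulFun (sepMap_coeff hπ)).injective (by
    rw [RingHom.id_apply, (mulFun (coeff hπ) (coeff hπ)).map_smul k (exists_comul hπ a).choose,
      (exists_comul hπ (k • a)).choose_spec,
      (exists_comul hπ a).choose_spec]
    ext p
    simp only [map_smul, Pi.smul_apply]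
    split_ifs <;> simp)

open Classical in
theorem mulFun_coeff_comul (h : equivariantSubalgebra hπ) :
    mulFun (coeff hπ) (coeff hπ) (comul hπ h) =
      fun p => if p.1 = p.2 then coeff hπ h p.1 else 0 := (exists_comul hπ h).choose_spec

/-- Each `σ` is multiplicative. Since evaluation separates tensors, this formula characterises
`comul` and reduces the coalgebra and bialgebra laws to identities in `L`. -/
theorem mulFun_ev_comul (h : equivariantSubalgebra hπ) (x y : L) :
    mulFun (ev hπ) (ev hπ) (comul hπ h) (x, y) = ev hπ h (x * y) := by
  classical
  rw [mulFun_ev, mulFun_coeff_comul, Fintype.sum_prod_type, ev_eq_sum]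
  refine Finset.sum_congr rfl fun σ _ => ?_
  rw [Finset.sum_eq_single σ]
  · simp
  · intro ρ _ h
    simp [h.symm]
  · simp

theorem exists_counit (h : equivariantSubalgebra hπ) : ∃ k, algebraMap K L k = ev hπ h 1 := by
  refine (IsGalois.mem_range_algebraMap_iff_fixed (F := K) _).2 fun τ => ?_
  simp only [ev_eq_sum, map_one, mul_one, map_sum]
  exact Fintype.sum_equiv (hπ.equiv τ) _ _ fun σ => (coeff_act hπ h τ σ).symm

/-- The counit, `ε h = h 1`. -/
noncomputable def counit : equivariantSubalgebra hπ →ₗ[K] K where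
  toFun h := (exists_counit hπ h).choose
  map_add' a b := (algebraMap K L).injective (by
    rw [(algebraMap K L).map_add, (exists_counit hπ (a + b)).choose_spec,
      (exists_counit hπ a).choose_spec, (exists_counit hπ b).choose_spec]
    rfl)
  map_smul' k a := (algebraMap K L).injective (by
    rw [RingHom.id_apply, smul_eq_mul, map_mul, (exists_counit hπ (k • a)).choose_spec,
      (exists_counit hπ a).choose_spec, ← Algebra.smul_def]
    rfl)

theorem algebraMap_counit (h : equivariantSubalgebra hπ) :
    algebraMap K L (counit hπ h) = ev hπ h 1 := (exists_counit hπ h).choose_spec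

theorem exists_antipode (h : equivariantSubalgebra hπ) :
    ∃ h', coeff hπ h' = fun σ => coeff hπ h (braceInv π σ) :=
  exists_coeff_eq hπ fun τ σ => by
    rw [← hπ.act_inv, coeff_act hπ h]

/-- The antipode, which inverts the grouplike elements. -/
noncomputable def antipode : equivariantSubalgebra hπ →ₗ[K] equivariantSubalgebra hπ where
  toFun h := (exists_antipode hπ h).choose
  map_add' a b := coeff_injective hπ (by
    rw [(coeff hπ).map_add (exists_antipode hπ a).choose, (exists_antipode hπ (a + b)).choose_spec,
      (exists_antipode hπ a).choose_spec, (exists_antipode hπ b).choose_spec, (coeff hπ).map_add]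
    rfl)
  map_smul' k a := coeff_injective hπ (by
    rw [RingHom.id_apply, (coeff hπ).map_smul k (exists_antipode hπ a).choose,
      (exists_antipode hπ (k • a)).choose_spec, (exists_antipode hπ a).choose_spec,
      (coeff hπ).map_smul]
    rfl)

theorem coeff_antipode (h : equivariantSubalgebra hπ) (σ : L ≃ₐ[K] L) :
    coeff hπ (antipode hπ h) σ = coeff hπ h (braceInv π σ) :=
  congrFun (exists_antipode hπ h).choose_spec σ

theorem coe_mul_eq (a b : equivariantSubalgebra hπ) :
    ((a * b).1 : L →ₗ[K] L) = ∑ p : (L ≃ₐ[K] L) × (L ≃ₐ[K] L),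
      (coeff hπ a p.1 * coeff hπ b p.2) • endGalBasis K L (braceOp π p.1 p.2) :=
  equivariantEnd_comp hπ a.1 b.2

end BraceHopf
end Construction

/-! ### The Hopf algebra laws and bijectivity of `θ` -/

namespace BraceHopf

section Laws

variable {K : Type u} {L : Type v} [Field K] [Field L] [Algebra K L]
variable [FiniteDimensional K L] [IsGalois K L]
variable {π : (L ≃ₐ[K] L) → (L ≃ₐ[K] L) → (L ≃ₐ[K] L)} (hπ : IsBraceAction π)

theorem ev_mul (a b : equivariantSubalgebra hπ) (x : L) :
    ev hπ (a * b) x = ev hπ a (ev hπ b x) := rfl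

theorem ev_one (x : L) : ev hπ 1 x = x := rfl

theorem mulFun_ev_one (x y : L) : mulFun (ev hπ) (ev hπ) 1 (x, y) = x * y := by
  rw [Algebra.TensorProduct.one_def, mulFun_tmul, ev_one, ev_one]

theorem tensor_ext {s t : equivariantSubalgebra hπ ⊗[K] equivariantSubalgebra hπ}
    (h : ∀ x y, mulFun (ev hπ) (ev hπ) s (x, y) = mulFun (ev hπ) (ev hπ) t (x, y)) : s = t :=
  ((sepMap_ev hπ).mulFun (sepMap_ev hπ)).injective (funext fun p => h p.1 p.2)

theorem mulFun_lTensor_comul (t : equivariantSubalgebra hπ ⊗[K] equivariantSubalgebra hπ)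
    (x y z : L) :
    mulFun (ev hπ) (mulFun (ev hπ) (ev hπ)) ((comul hπ).lTensor _ t) (x, y, z) =
      mulFun (ev hπ) (ev hπ) t (x, y * z) := by
  induction t with
  | zero => simp only [LinearMap.map_zero, Pi.zero_apply]
  | add s t hs ht => simp only [map_add, Pi.add_apply, hs, ht]
  | tmul a b => simp [mulFun_ev_comul]

theorem mulFun_rTensor_comul (t : equivariantSubalgebra hπ ⊗[K] equivariantSubalgebra hπ)
    (x y z : L) :
    mulFun (mulFun (ev hπ) (ev hπ)) (ev hπ) ((comul hπ).rTensor _ t) ((x, y), z) =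
      mulFun (ev hπ) (ev hπ) t (x * y, z) := by
  induction t with
  | zero => simp only [LinearMap.map_zero, Pi.zero_apply]
  | add s t hs ht => simp only [map_add, Pi.add_apply, hs, ht]
  | tmul a b => simp [mulFun_ev_comul]

omit [FiniteDimensional K L] [IsGalois K L] in
theorem mulFun_assoc {M N P X Y Z : Type*} [AddCommMonoid M] [Module K M] [AddCommMonoid N]
    [Module K N] [AddCommMonoid P] [Module K P] (φ : M →ₗ[K] X → L) (ψ : N →ₗ[K] Y → L)
    (χ : P →ₗ[K] Z → L) (t : (M ⊗[K] N) ⊗[K] P) (x : X) (y : Y) (z : Z) :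
    mulFun φ (mulFun ψ χ) (TensorProduct.assoc K M N P t) (x, y, z) =
      mulFun (mulFun φ ψ) χ t ((x, y), z) := by
  induction t with
  | zero => simp only [LinearEquiv.map_zero, LinearMap.map_zero, Pi.zero_apply]
  | add s t hs ht => simp only [map_add, Pi.add_apply, hs, ht]
  | tmul a c =>
    induction a with
    | zero => simp only [TensorProduct.zero_tmul, LinearEquiv.map_zero, LinearMap.map_zero,
        Pi.zero_apply]
    | add s t hs ht =>
      simp only [TensorProduct.add_tmul, map_add, Pi.add_apply, hs, ht]
    | tmul a b => simp [mul_assoc]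

theorem ev_lid_rTensor_counit (t : equivariantSubalgebra hπ ⊗[K] equivariantSubalgebra hπ)
    (x : L) : ev hπ (TensorProduct.lid K _ ((counit hπ).rTensor _ t)) x =
      mulFun (ev hπ) (ev hπ) t (1, x) := by
  induction t with
  | zero => simp only [LinearEquiv.map_zero, LinearMap.map_zero, Pi.zero_apply]
  | add s t hs ht => simp only [map_add, Pi.add_apply, hs, ht]
  | tmul a b =>
    rw [LinearMap.rTensor_tmul, TensorProduct.lid_tmul, map_smul, Pi.smul_apply, Algebra.smul_def,
      algebraMap_counit, mulFun_tmul]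

theorem ev_rid_lTensor_counit (t : equivariantSubalgebra hπ ⊗[K] equivariantSubalgebra hπ)
    (x : L) : ev hπ (TensorProduct.rid K _ ((counit hπ).lTensor _ t)) x =
      mulFun (ev hπ) (ev hπ) t (x, 1) := by
  induction t with
  | zero => simp only [LinearEquiv.map_zero, LinearMap.map_zero, Pi.zero_apply]
  | add s t hs ht => simp only [map_add, Pi.add_apply, hs, ht]
  | tmul a b =>
    rw [LinearMap.lTensor_tmul, TensorProduct.rid_tmul, map_smul, Pi.smul_apply, Algebra.smul_def,
      algebraMap_counit, mulFun_tmul, mul_comm]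

theorem mulFun_ev_mul_tmul (s : equivariantSubalgebra hπ ⊗[K] equivariantSubalgebra hπ)
    (a b : equivariantSubalgebra hπ) (x y : L) :
    mulFun (ev hπ) (ev hπ) (s * a ⊗ₜ b) (x, y) =
      mulFun (ev hπ) (ev hπ) s (ev hπ a x, ev hπ b y) := by
  induction s with
  | zero => simp only [zero_mul, LinearMap.map_zero, Pi.zero_apply]
  | add s t hs ht => simp only [add_mul, map_add, Pi.add_apply, hs, ht]
  | tmul c d => simp [ev_mul]

theorem mulFun_ev_comul_mul (h : equivariantSubalgebra hπ)
    (t : equivariantSubalgebra hπ ⊗[K] equivariantSubalgebra hπ) (x y : L) :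
    mulFun (ev hπ) (ev hπ) (comul hπ h * t) (x, y) =
      ev hπ h (mulFun (ev hπ) (ev hπ) t (x, y)) := by
  induction t with
  | zero => simp [ev_apply]
  | add s t hs ht =>
    simp only [mul_add, map_add, Pi.add_apply, hs, ht]
    exact (h.1.map_add _ _).symm
  | tmul a b => rw [mulFun_ev_mul_tmul, mulFun_ev_comul, mulFun_tmul]

theorem mulFun_ev_comm (t : equivariantSubalgebra hπ ⊗[K] equivariantSubalgebra hπ) (x y : L) :
    mulFun (ev hπ) (ev hπ) (TensorProduct.comm K _ _ t) (x, y) =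
      mulFun (ev hπ) (ev hπ) t (y, x) := by
  induction t with
  | zero => simp only [LinearEquiv.map_zero, LinearMap.map_zero, Pi.zero_apply]
  | add s t hs ht => simp only [map_add, Pi.add_apply, hs, ht]
  | tmul a b => simp [mul_comm]

theorem coe_mul_rTensor_antipode
    (t : equivariantSubalgebra hπ ⊗[K] equivariantSubalgebra hπ) :
    ((LinearMap.mul' K _ ((antipode hπ).rTensor _ t)).1 : L →ₗ[K] L) =
      ∑ p : (L ≃ₐ[K] L) × (L ≃ₐ[K] L), mulFun (coeff hπ) (coeff hπ) t p •
        endGalBasis K L (braceOp π (braceInv π p.1) p.2) := by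
  induction t with
  | zero => simp
  | add s t hs ht =>
    simp only [map_add, Pi.add_apply, add_smul, Finset.sum_add_distrib, ← hs, ← ht]
    rfl
  | tmul a b =>
    rw [LinearMap.rTensor_tmul, LinearMap.mul'_apply, coe_mul_eq]
    refine Fintype.sum_equiv (hπ.invEquiv.prodCongr (Equiv.refl _)) _ _ fun p => ?_
    simp [coeff_antipode, hπ.inv_inv]

theorem coe_mul_lTensor_antipode
    (t : equivariantSubalgebra hπ ⊗[K] equivariantSubalgebra hπ) :
    ((LinearMap.mul' K _ ((antipode hπ).lTensor _ t)).1 : L →ₗ[K] L) =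
      ∑ p : (L ≃ₐ[K] L) × (L ≃ₐ[K] L), mulFun (coeff hπ) (coeff hπ) t p •
        endGalBasis K L (braceOp π p.1 (braceInv π p.2)) := by
  induction t with
  | zero => simp
  | add s t hs ht =>
    simp only [map_add, Pi.add_apply, add_smul, Finset.sum_add_distrib, ← hs, ← ht]
    rfl
  | tmul a b =>
    rw [LinearMap.lTensor_tmul, LinearMap.mul'_apply, coe_mul_eq]
    refine Fintype.sum_equiv ((Equiv.refl _).prodCongr hπ.invEquiv) _ _ fun p => ?_
    simp [coeff_antipode, hπ.inv_inv]

open Classical in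
theorem sum_diagonal (h : equivariantSubalgebra hπ)
    (f : (L ≃ₐ[K] L) × (L ≃ₐ[K] L) → (L ≃ₐ[K] L)) (hf : ∀ σ, f (σ, σ) = 1) :
    ∑ p : (L ≃ₐ[K] L) × (L ≃ₐ[K] L), mulFun (coeff hπ) (coeff hπ) (comul hπ h) p •
        endGalBasis K L (f p) =
      ((algebraMap K (equivariantSubalgebra hπ) (counit hπ h)).1 : L →ₗ[K] L) := by
  rw [mulFun_coeff_comul, Fintype.sum_prod_type]
  have : ∀ σ, ∑ ρ, (if σ = ρ then coeff hπ h σ else 0) • endGalBasis K L (f (σ, ρ)) =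
      coeff hπ h σ • (1 : L ≃ₐ[K] L).toLinearMap := fun σ => by
    rw [Finset.sum_eq_single σ]
    · rw [if_pos rfl, hf, endGalBasis_apply]
    · intro ρ _ hρ
      rw [if_neg hρ.symm, zero_smul]
    · simp
  simp only [this]
  ext x
  rw [LinearMap.sum_apply]
  simp only [LinearMap.smul_apply, AlgEquiv.toLinearMap_apply, AlgEquiv.one_apply, smul_eq_mul]
  rw [← Finset.sum_mul]
  have h1 : ev hπ h 1 = ∑ σ, coeff hπ h σ := by rw [ev_eq_sum]; simp
  rw [← h1, ← algebraMap_counit, ← Algebra.smul_def]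
  rfl

theorem mul_map_act (t : equivariantSubalgebra hπ ⊗[K] equivariantSubalgebra hπ) (x y : L) :
    LinearMap.mul' K L (TensorProduct.map
      ((equivariantSubalgebra hπ).val.toLinearMap.flip x)
      ((equivariantSubalgebra hπ).val.toLinearMap.flip y) t) =
      mulFun (ev hπ) (ev hπ) t (x, y) := by
  induction t with
  | zero => simp only [LinearMap.map_zero, Pi.zero_apply]
  | add s t hs ht => simp only [map_add, Pi.add_apply, hs, ht]
  | tmul a b => simp [ev_apply]

/-- The coalgebra structure for which the elements of the Galois group are grouplike. -/
noncomputable abbrev coalgebra : Coalgebra K (equivariantSubalgebra hπ) :=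
  { comul := comul hπ
    counit := counit hπ
    coassoc := LinearMap.ext fun h =>
      ((sepMap_ev hπ).mulFun ((sepMap_ev hπ).mulFun (sepMap_ev hπ))).injective
        (funext fun ⟨x, y, z⟩ => by
          simp only [LinearMap.comp_apply, LinearEquiv.coe_coe]
          rw [mulFun_assoc, mulFun_lTensor_comul, mulFun_rTensor_comul, mulFun_ev_comul,
            mulFun_ev_comul, mul_assoc])
    rTensor_counit_comp_comul := LinearMap.ext fun h =>
      (TensorProduct.lid K _).injective ((sepMap_ev hπ).injective (funext fun x => by
        rw [LinearMap.comp_apply, ev_lid_rTensor_counit, mulFun_ev_comul, one_mul]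
        simp))
    lTensor_counit_comp_comul := LinearMap.ext fun h =>
      (TensorProduct.rid K _).injective ((sepMap_ev hπ).injective (funext fun x => by
        rw [LinearMap.comp_apply, ev_rid_lTensor_counit, mulFun_ev_comul, mul_one]
        simp)) }

/-- The bialgebra structure for which the elements of the Galois group are grouplike. -/
noncomputable abbrev bialgebra : Bialgebra K (equivariantSubalgebra hπ) :=
  letI := coalgebra hπ
  Bialgebra.mk' K _
    ((algebraMap K L).injective (by
      rw [(algebraMap K L).map_one]; exact (algebraMap_counit hπ 1).trans (ev_one hπ 1)))
    (fun {a b} => (algebraMap K L).injective (by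
      rw [(algebraMap K L).map_mul]
      change algebraMap K L (counit hπ (a * b)) =
        algebraMap K L (counit hπ a) * algebraMap K L (counit hπ b)
      rw [algebraMap_counit, algebraMap_counit, ev_mul, ← algebraMap_counit hπ b, mul_comm,
        ← Algebra.smul_def, ev_apply, ev_apply, ← map_smul, Algebra.smul_def, mul_one]))
    (tensor_ext hπ fun x y => by
      rw [mulFun_ev_one]; exact mulFun_ev_comul hπ 1 x y)
    (fun {a b} => tensor_ext hπ fun x y => by
      change mulFun _ _ (comul hπ (a * b)) _ = mulFun _ _ (comul hπ a * comul hπ b) _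
      rw [mulFun_ev_comul_mul, mulFun_ev_comul, mulFun_ev_comul, ev_mul])

/-- The Hopf algebra structure for which the elements of the Galois group are grouplike. -/
noncomputable abbrev hopfAlgebra : HopfAlgebra K (equivariantSubalgebra hπ) :=
  letI := bialgebra hπ
  { antipode := antipode hπ
    mul_antipode_rTensor_comul := LinearMap.ext fun h => Subtype.ext <|
      (coe_mul_rTensor_antipode hπ (comul hπ h)).trans
        (sum_diagonal hπ h _ fun σ => hπ.inv_op σ)
    mul_antipode_lTensor_comul := LinearMap.ext fun h => Subtype.ext <|
      (coe_mul_lTensor_antipode hπ (comul hπ h)).trans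
        (sum_diagonal hπ h _ fun σ => hπ.op_inv σ) }

theorem isCocomm : @Coalgebra.IsCocomm K (equivariantSubalgebra hπ) _ _ _ (coalgebra hπ) :=
  letI := coalgebra hπ
  ⟨LinearMap.ext fun h => tensor_ext hπ fun x y => by
    rw [LinearMap.comp_apply]
    exact (mulFun_ev_comm hπ (comul hπ h) x y).trans
      ((mulFun_ev_comul hπ h y x).trans
        ((congrArg _ (mul_comm y x)).trans (mulFun_ev_comul hπ h x y).symm))⟩

end Laws

/-- The equivariant endomorphisms span `End_K L` over `L`, so a relation satisfied by all of them
holds for every endomorphism. -/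
theorem sum_mul_eq_zero {K : Type u} {L : Type v} [Field K] [Field L] [Algebra K L]
    [FiniteDimensional K L] [IsGalois K L] {π : (L ≃ₐ[K] L) → (L ≃ₐ[K] L) → (L ≃ₐ[K] L)}
    (hπ : IsBraceAction π) {ι : Type*} (s : Finset ι) (x y : ι → L)
    (h0 : ∀ h : equivariantSubalgebra hπ, ∑ i ∈ s, x i * h.1 (y i) = 0) (T : L →ₗ[K] L) :
    ∑ i ∈ s, x i * T (y i) = 0 := by
  obtain ⟨b, B, hB⟩ := exists_basis hπ
  have hT : T = ∑ j, b.repr ((endGalBasis K L).equivFun T) j • (B j).1 := by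
    apply (endGalBasis K L).equivFun.injective
    conv_lhs => rw [← b.sum_repr ((endGalBasis K L).equivFun T)]
    rw [map_sum]
    refine Finset.sum_congr rfl fun j _ => ?_
    rw [map_smul, ← hB]
    rfl
  have hTx : ∀ i, T (y i) = ∑ j, b.repr ((endGalBasis K L).equivFun T) j * (B j).1 (y i) :=
    fun i => by
      conv_lhs => rw [hT, LinearMap.sum_apply]
      rfl
  simp only [hTx, Finset.mul_sum]
  rw [Finset.sum_comm]
  refine Finset.sum_eq_zero fun j _ => ?_
  rw [← mul_zero (b.repr ((endGalBasis K L).equivFun T) j), ← h0 (B j), Finset.mul_sum]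
  exact Finset.sum_congr rfl fun i _ => by ring

theorem bijective_hopfGaloisTheta {K : Type u} {L : Type v} [Field K] [Field L] [Algebra K L]
    [FiniteDimensional K L] {H : Type u} [Ring H] [Algebra K H] [Module.Finite K H]
    (ρ : H →ₐ[K] Module.End K L) (hrank : Module.finrank K H = Module.finrank K L)
    (hspan : ∀ (s : Finset (Fin (Module.finrank K L))) (x y : Fin (Module.finrank K L) → L),
      (∀ h : H, ∑ i ∈ s, x i * ρ h (y i) = 0) →
        ∀ T : L →ₗ[K] L, ∑ i ∈ s, x i * T (y i) = 0) :
    Function.Bijective (hopfGaloisTheta ρ) := by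
  classical
  have hinj : Function.Injective (hopfGaloisTheta ρ) := by
    rw [injective_iff_map_eq_zero]
    intro t ht
    let Y := Module.finBasis K L
    obtain ⟨c, rfl⟩ := TensorProduct.eq_repr_basis_right Y t
    have key := hspan c.support c Y fun h => by
      have := LinearMap.congr_fun ht h
      rw [Finsupp.sum, map_sum, LinearMap.sum_apply] at this
      simp only [hopfGaloisTheta_tmul] at this
      exact this
    have hc : c = 0 := by
      ext j
      -- Taking the `j`-th coordinate functional as the endomorphism isolates the coefficient `c j`.
      have := key (Algebra.linearMap K L ∘ₗ Y.coord j)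
      simp only [LinearMap.comp_apply, Module.Basis.coord_apply, Module.Basis.repr_self,
        Algebra.linearMap_apply, Finsupp.single_apply] at this
      by_contra hj
      rw [Finset.sum_eq_single j] at this
      · exact hj (by simpa using this)
      · intro i _ hi
        simp [hi]
      · exact fun h => absurd (Finsupp.notMem_support_iff.1 h) hj
    simp [hc]
  refine ⟨hinj, (LinearMap.injective_iff_surjective_of_finrank_eq_finrank ?_).1 hinj⟩
  rw [Module.finrank_tensorProduct, Module.finrank_linearMap, hrank]

/-- The Hopf-Galois structure of a brace action. -/
noncomputable def hopfGaloisStructure {K L : Type u} [Field K] [Field L] [Algebra K L]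
    [FiniteDimensional K L] [IsGalois K L] {π : (L ≃ₐ[K] L) → (L ≃ₐ[K] L) → (L ≃ₐ[K] L)}
    (hπ : IsBraceAction π) : HopfGaloisStructure K L where
  H := equivariantSubalgebra hπ
  hopf := hopfAlgebra hπ
  cocomm := isCocomm hπ
  act := (equivariantSubalgebra hπ).val
  act_mul h x y := ((mul_map_act hπ (comul hπ h) x y).trans (mulFun_ev_comul hπ h x y)).symm
  act_algebraMap h k := by
    rw [map_mul]
    refine Eq.trans ?_ (congrArg (· * algebraMap K L k) (algebraMap_counit hπ h).symm)
    change h.1 _ = h.1 1 * _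
    rw [Algebra.algebraMap_eq_smul_one, map_smul, Algebra.smul_def, Algebra.smul_def, mul_one,
      mul_comm]
  bijective_theta := by
    let := hopfAlgebra hπ
    exact bijective_hopfGaloisTheta (H := equivariantSubalgebra hπ) _ (finrank_eq hπ)
      fun s x y h0 => sum_mul_eq_zero hπ s x y h0

end BraceHopf

/-! ### Isomorphism classes correspond to brace actions -/

section Classify

variable {K : Type u} {L : Type v} [Field K] [Field L] [Algebra K L]
variable [FiniteDimensional K L] [IsGalois K L]

/-- The equivariant functions for `π` span all functions over `L`, hence every `f` takes the same
value at `π τ σ` and `π' τ σ`; a delta function then separates the two points. -/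
theorem equivariantEnd_injective {π π' : (L ≃ₐ[K] L) → (L ≃ₐ[K] L) → (L ≃ₐ[K] L)}
    (hπ : IsBraceAction π) (h : ∀ X, X ∈ equivariantEnd π → X ∈ equivariantEnd π') : π = π' := by
  classical
  funext τ σ
  have hspan := IsEquivariant.span_eq_top hπ.one_act hπ.mul_act
  have key : ∀ f : (L ≃ₐ[K] L) → L, f (π τ σ) = f (π' τ σ) := fun f => by
    have hf : f ∈ Submodule.span L {f : (L ≃ₐ[K] L) → L | IsEquivariant π f} :=
      hspan ▸ Submodule.mem_top
    induction hf using Submodule.span_induction with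
    | mem f hf =>
      obtain ⟨X, rfl⟩ := BraceHopf.exists_coeff_eq hπ hf
      rw [BraceHopf.coeff_apply, BraceHopf.coeff_apply, X.2 τ σ, h X.1 X.2 τ σ]
    | zero => rfl
    | add f g _ _ hf hg => rw [Pi.add_apply, Pi.add_apply, hf, hg]
    | smul l f _ hf => rw [Pi.smul_apply, Pi.smul_apply, hf]
  have := key (Pi.single (π τ σ) 1)
  by_contra hne
  simp [Ne.symm hne] at this

namespace HopfGaloisStructure

theorem galAct_eq_of_rel {A B : HopfGaloisStructure K L}
    (h : HopfGaloisStructure.setoid K L A B) : A.galAct = B.galAct := by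
  obtain ⟨f, hf⟩ := h
  refine equivariantEnd_injective A.isBraceAction_galAct fun X hX => ?_
  rw [mem_equivariantEnd_galAct] at hX ⊢
  obtain ⟨h, rfl⟩ := hX
  exact ⟨f h, LinearMap.ext (hf h)⟩

omit [IsGalois K L] in
theorem tensor_ext (A : HopfGaloisStructure K L) {s t : A.H ⊗[K] A.H}
    (h : ∀ x y, LinearMap.mul' K L
        (TensorProduct.map (A.act.toLinearMap.flip x) (A.act.toLinearMap.flip y) s) =
      LinearMap.mul' K L
        (TensorProduct.map (A.act.toLinearMap.flip x) (A.act.toLinearMap.flip y) t)) : s = t := by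
  let b := A.basisH.tensorProduct A.basisH
  have key : ∀ (t : A.H ⊗[K] A.H) x y, LinearMap.mul' K L
        (TensorProduct.map (A.act.toLinearMap.flip x) (A.act.toLinearMap.flip y) t) =
      ∑ p, algebraMap K L (b.repr t p) * (A.endBasis p.1 x * A.endBasis p.2 y) := fun t x y => by
    conv_lhs => rw [← b.sum_repr t]
    simp only [b, map_sum, map_smul, Module.Basis.tensorProduct_apply', TensorProduct.map_tmul,
      LinearMap.mul'_apply, LinearMap.flip_apply, AlgHom.toLinearMap_apply, endBasis_apply]
    exact Finset.sum_congr rfl fun p _ => Algebra.smul_def _ _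
  have := A.eq_zero_of_sum_endBasis_mul
    (fun p => algebraMap K L (b.repr s p) - algebraMap K L (b.repr t p)) fun x y => by
      simp only [sub_mul, Finset.sum_sub_distrib]
      rw [← key, ← key, h, sub_self]
  refine b.repr.injective (Finsupp.ext fun p => (algebraMap K L).injective ?_)
  exact sub_eq_zero.1 (congrFun this p)

/-- Both Hopf algebras act faithfully with the same image. The transported algebra isomorphism
respects the coalgebra structures because the action on products determines `Δ` and the action on
`1` determines `ε`. -/
theorem rel_of_galAct_eq {A B : HopfGaloisStructure K L} (h : A.galAct = B.galAct) :
    HopfGaloisStructure.setoid K L A B := by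
  have hrange : A.act.range = B.act.range := by
    ext X
    rw [AlgHom.mem_range, AlgHom.mem_range]
    exact (A.mem_equivariantEnd_galAct X).symm.trans
      (by rw [h]; exact B.mem_equivariantEnd_galAct X)
  let f : A.H ≃ₐ[K] B.H := (AlgEquiv.ofInjective A.act A.act_injective).trans
    ((Subalgebra.equivOfEq _ _ hrange).trans (AlgEquiv.ofInjective B.act B.act_injective).symm)
  have hf : ∀ a, B.act (f a) = A.act a := fun a => by
    have := congrArg Subtype.val ((AlgEquiv.ofInjective B.act B.act_injective).apply_symm_apply
      (Subalgebra.equivOfEq _ _ hrange (AlgEquiv.ofInjective A.act A.act_injective a)))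
    exact this
  have hmap : ∀ (t : A.H ⊗[K] A.H) x y, LinearMap.mul' K L
        (TensorProduct.map (B.act.toLinearMap.flip x) (B.act.toLinearMap.flip y)
          (TensorProduct.map f.toLinearMap f.toLinearMap t)) =
      LinearMap.mul' K L
        (TensorProduct.map (A.act.toLinearMap.flip x) (A.act.toLinearMap.flip y) t) :=
    fun t x y => by
      induction t with
      | zero => simp
      | add s t hs ht => simp only [map_add, hs, ht]
      | tmul a b => simp [hf]
  refine ⟨BialgEquiv.ofAlgEquiv f ?_ ?_, fun a x => LinearMap.congr_fun (hf a) x⟩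
  · refine AlgHom.ext fun a => (algebraMap K L).injective ?_
    have hA := A.act_algebraMap a 1
    have hB := B.act_algebraMap (f a) 1
    rw [mul_one] at hA hB
    rw [hf, hA] at hB
    exact hB.symm
  · refine AlgHom.ext fun a => B.tensor_ext fun x y => ?_
    refine (hmap (Coalgebra.comul a) x y).trans ?_
    refine (A.act_mul a x y).symm.trans ?_
    rw [← hf]
    exact B.act_mul (f a) x y

end HopfGaloisStructure
end Classify

theorem galAct_hopfGaloisStructure {K L : Type u} [Field K] [Field L] [Algebra K L]
    [FiniteDimensional K L] [IsGalois K L] {π : (L ≃ₐ[K] L) → (L ≃ₐ[K] L) → (L ≃ₐ[K] L)}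
    (hπ : IsBraceAction π) : (BraceHopf.hopfGaloisStructure hπ).galAct = π := by
  symm
  refine equivariantEnd_injective hπ fun X hX => ?_
  rw [HopfGaloisStructure.mem_equivariantEnd_galAct]
  exact ⟨(⟨X, hX⟩ : equivariantSubalgebra hπ), rfl⟩

/-- Hopf-Galois structures up to isomorphism correspond to brace actions. -/
noncomputable def hopfGaloisClassesEquiv (K L : Type u) [Field K] [Field L] [Algebra K L]
    [FiniteDimensional K L] [IsGalois K L] :
    HopfGaloisClasses K L ≃
      {π : (L ≃ₐ[K] L) → (L ≃ₐ[K] L) → (L ≃ₐ[K] L) // IsBraceAction π} :=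
  Equiv.ofBijective
    (Quotient.lift (fun A : HopfGaloisStructure K L =>
        (⟨A.galAct, A.isBraceAction_galAct⟩ : {π // IsBraceAction π}))
      fun _ _ h => Subtype.ext (HopfGaloisStructure.galAct_eq_of_rel h))
    ⟨fun a b => Quotient.inductionOn₂ a b fun _ _ h =>
        Quotient.sound (HopfGaloisStructure.rel_of_galAct_eq (congrArg Subtype.val h)),
      fun π => ⟨Quotient.mk _ (BraceHopf.hopfGaloisStructure π.2),
        Subtype.ext (galAct_hopfGaloisStructure π.2)⟩⟩

/-! ### Transport along isomorphisms -/

section Transport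

/-- Transport of a Hopf-Galois structure along an isomorphism of extensions. -/
noncomputable def HopfGaloisStructure.transport {K : Type u} {L : Type*} {L' : Type*} [Field K]
    [Field L] [Field L'] [Algebra K L] [Algebra K L'] (e : L ≃ₐ[K] L')
    (A : HopfGaloisStructure K L) : HopfGaloisStructure K L' where
  H := A.H
  act := (e.toLinearEquiv.conjAlgEquiv K).toAlgHom.comp A.act
  act_mul h x y := by
    have key : ∀ t : A.H ⊗[K] A.H,
        e (LinearMap.mul' K L (TensorProduct.map (A.act.toLinearMap.flip (e.symm x))
          (A.act.toLinearMap.flip (e.symm y)) t)) =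
        LinearMap.mul' K L' (TensorProduct.map
          (((e.toLinearEquiv.conjAlgEquiv K).toAlgHom.comp A.act).toLinearMap.flip x)
          (((e.toLinearEquiv.conjAlgEquiv K).toAlgHom.comp A.act).toLinearMap.flip y) t) := fun t => by
      induction t with
      | zero => simp
      | add s t hs ht => simp only [map_add, hs, ht]
      | tmul a b => simp [LinearEquiv.conjAlgEquiv_apply]
    rw [← key, ← A.act_mul, ← map_mul]
    rfl
  act_algebraMap h k := by
    change e (A.act h (e.symm (algebraMap K L' k))) = _
    rw [AlgEquiv.commutes, A.act_algebraMap, AlgEquiv.commutes]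
  bijective_theta := by
    have : (hopfGaloisTheta ((e.toLinearEquiv.conjAlgEquiv K).toAlgHom.comp A.act)).comp
        (TensorProduct.congr e.toLinearEquiv e.toLinearEquiv).toLinearMap =
        (LinearEquiv.congrRight e.toLinearEquiv).toLinearMap.comp (hopfGaloisTheta A.act) := by
      ext x y h
      simp only [TensorProduct.AlgebraTensorModule.curry_apply, TensorProduct.curry_apply,
        LinearMap.coe_restrictScalars, LinearMap.comp_apply, LinearEquiv.coe_coe,
        TensorProduct.congr_tmul, hopfGaloisTheta_tmul]
      refine Eq.trans ?_ (congrArg e (hopfGaloisTheta_tmul A.act x y h)).symm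
      simp [LinearEquiv.conjAlgEquiv_apply]
    have h2 : Function.Bijective
        (hopfGaloisTheta ((e.toLinearEquiv.conjAlgEquiv K).toAlgHom.comp A.act) ∘
        (TensorProduct.congr e.toLinearEquiv e.toLinearEquiv)) := by
      have h3 := congrArg (fun (F : (L ⊗[K] L) →ₗ[K] (A.H →ₗ[K] L')) => (F : (L ⊗[K] L) → (A.H →ₗ[K] L'))) this
      refine Eq.mp (congrArg Function.Bijective h3.symm) ?_
      exact (LinearEquiv.congrRight e.toLinearEquiv).bijective.comp A.bijective_theta
    exact ((TensorProduct.congr e.toLinearEquiv e.toLinearEquiv).bijective.of_comp_iff _).1 h2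

/-- Isomorphic extensions have the same Hopf-Galois structures. -/
noncomputable def hopfGaloisClassesCongr {K : Type u} {L : Type*} {L' : Type*} [Field K]
    [Field L] [Field L'] [Algebra K L] [Algebra K L'] (e : L ≃ₐ[K] L') :
    HopfGaloisClasses K L ≃ HopfGaloisClasses K L' where
  toFun := Quotient.map (HopfGaloisStructure.transport e) fun A B ⟨f, hf⟩ =>
    ⟨f, fun h x => by
      exact congrArg e (hf h (e.symm x))⟩
  invFun := Quotient.map (HopfGaloisStructure.transport e.symm) fun A B ⟨f, hf⟩ =>
    ⟨f, fun h x => by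
      exact congrArg e.symm (hf h (e x))⟩
  left_inv a := Quotient.inductionOn a fun A => Quotient.sound
    ⟨BialgEquiv.refl K A.H, fun h x => by
      change A.act h x = e.symm (e (A.act h (e.symm (e x))))
      simp⟩
  right_inv a := Quotient.inductionOn a fun A => Quotient.sound
    ⟨BialgEquiv.refl K A.H, fun h x => by
      change A.act h x = e (e.symm (A.act h (e (e.symm x))))
      simp⟩

/-- Isomorphic groups have the same brace actions. -/
def braceActionCongr {Γ Γ' : Type*} [Group Γ] [Group Γ'] (e : Γ ≃* Γ') :
    {π : Γ → Γ → Γ // IsBraceAction π} ≃ {π : Γ' → Γ' → Γ' // IsBraceAction π} where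
  toFun π := ⟨fun a b => e (π.1 (e.symm a) (e.symm b)), by
    obtain ⟨π, h1, h2, h3, h4⟩ := π
    exact ⟨by simp [h1], by simp [h2], by simp [h3], by simp [h4]⟩⟩
  invFun π := ⟨fun a b => e.symm (π.1 (e a) (e b)), by
    obtain ⟨π, h1, h2, h3, h4⟩ := π
    exact ⟨by simp [h1], by simp [h2], by simp [h3], by simp [h4]⟩⟩
  left_inv π := by ext; simp
  right_inv π := by ext; simp

/-- The algebra of equivariant endomorphisms lives in the universe of `L`, whereas `H` must live in
that of `K`. Being finite-dimensional, `L` has a copy in the smaller universe. -/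
theorem nonempty_hopfGaloisClasses_equiv (K : Type u) (L : Type v) [Field K] [Field L]
    [Algebra K L] [FiniteDimensional K L] [IsGalois K L] :
    Nonempty (HopfGaloisClasses K L ≃
      {π : (L ≃ₐ[K] L) → (L ≃ₐ[K] L) → (L ≃ₐ[K] L) // IsBraceAction π}) := by
  have : Small.{u} L := small_of_injective (Module.finBasis K L).equivFun.injective
  let e : L ≃ₐ[K] Shrink.{u} L := (Shrink.algEquiv K L).symm
  have : FiniteDimensional K (Shrink.{u} L) := Module.Finite.equiv e.toLinearEquiv
  have : IsGalois K (Shrink.{u} L) := IsGalois.of_algEquiv e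
  exact ⟨(hopfGaloisClassesCongr e).trans ((hopfGaloisClassesEquiv K (Shrink.{u} L)).trans
    (braceActionCongr (AlgEquiv.autCongr e.symm)))⟩

end Transport

/-! ### Skew braces with abelian multiplicative group, one prime at a time -/

/-- A skew brace with commutative multiplicative group, presented by a bijection `e` from the
multiplicative group `A`, written additively, to the additive group `G`, written
multiplicatively. -/
structure IsBraceEquiv {A G : Type*} [AddCommGroup A] [Group G] (e : A ≃ G) : Prop where
  apply_zero : e 0 = 1
  distrib : ∀ a x y, e (a + e.symm (x * y)) = e (a + e.symm x) * (e a)⁻¹ * e (a + e.symm y)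

namespace IsBraceEquiv

variable {A G : Type*} [AddCommGroup A] [Group G] {e : A ≃ G}

/-- The action of `A` on `G` by automorphisms. -/
def lam (he : IsBraceEquiv e) (a : A) : MulAut G where
  toFun x := (e a)⁻¹ * e (a + e.symm x)
  invFun x := e (-a + e.symm (e a * x))
  left_inv x := by simp
  right_inv x := by simp
  map_mul' x y := by rw [he.distrib]; group

variable (he : IsBraceEquiv e)
include he

theorem lam_apply (a : A) (x : G) : he.lam a x = (e a)⁻¹ * e (a + e.symm x) := rfl

theorem apply_add (a b : A) : e (a + b) = e a * he.lam a (e b) := by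
  simp [lam_apply]

theorem lam_zero (x : G) : he.lam 0 x = x := by simp [lam_apply, he.apply_zero]

theorem lam_add (a b : A) (x : G) : he.lam (a + b) x = he.lam a (he.lam b x) := by
  obtain ⟨c, rfl⟩ := e.surjective x
  have h := he.apply_add (a + b) c
  rw [add_assoc, he.apply_add a (b + c), he.apply_add b c, he.apply_add a b, map_mul, ← mul_assoc] at h
  exact (mul_left_cancel h).symm

omit he in
theorem op (he : IsBraceEquiv e) : IsBraceEquiv (e.trans MulOpposite.opEquiv) where
  apply_zero := by simp [he.apply_zero]
  distrib a x y := by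
    simp only [Equiv.trans_apply, MulOpposite.opEquiv_apply, Equiv.symm_trans_apply,
      MulOpposite.opEquiv_symm_apply, MulOpposite.unop_mul, he.distrib, MulOpposite.op_mul,
      MulOpposite.op_inv, mul_assoc]

section Prime

variable {p : ℕ} [Fact p.Prime] {s : ZMod p →+ A} {u : A →+ ZMod p}

-- The kernel of `u` has order prime to `p`, so `r` vanishes on it; modulo the kernel, `A` is the
-- image of `s`.
omit he in
theorem _root_.AddMonoidHom.eq_mul_of_coprime_ker [Finite A] (hus : ∀ x, u (s x) = x)
    (hker : (Nat.card u.ker).Coprime p) (r : A →+ ZMod p) (a : A) : r a = r (s 1) * u a := by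
  have h1 : r (a - s (u a)) = 0 := by
    have hmem : a - s (u a) ∈ u.ker := by simp [AddMonoidHom.mem_ker, hus]
    have hc : Nat.card u.ker • (a - s (u a)) = 0 := by
      have : Nat.card u.ker • (⟨_, hmem⟩ : u.ker) = 0 := card_nsmul_eq_zero'
      exact congrArg Subtype.val this
    have h2 : (Nat.card u.ker : ZMod p) * r (a - s (u a)) = 0 := by
      rw [← nsmul_eq_mul, ← map_nsmul, hc, map_zero]
    refine (mul_eq_zero.1 h2).resolve_left fun h => ?_
    rw [ZMod.natCast_eq_zero_iff] at h
    exact (Fact.out : p.Prime).one_lt.ne' (Nat.dvd_one.1 (hker ▸ Nat.dvd_gcd h dvd_rfl))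
  have h2 : ∀ x : ZMod p, r (s x) = r (s 1) * x := fun x => by
    obtain ⟨k, rfl⟩ := ZMod.natCast_zmod_surjective x
    rw [← nsmul_one k, map_nsmul, map_nsmul, nsmul_eq_mul, nsmul_eq_mul, mul_one,
      mul_comm]
  rw [← h2, ← sub_eq_zero, ← map_sub, h1]

-- The kernel of `u` is a transversal for the cosets of the image of `s`. The map `φ` permutes these
-- cosets, and `g` is constant on them.
omit he in
theorem sum_ker_comp [Finite A] [Fintype u.ker] (hus : ∀ x, u (s x) = x) {φ : A → A}
    (hφ : Function.Injective φ) (hφs : ∀ b y, ∃ y', φ b + s y = φ (b + s y')) {g : A → ZMod p}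
    (hg : ∀ b y, g (b + s y) = g b) : ∑ c : u.ker, g (φ c) = ∑ c : u.ker, g c := by
  let T : u.ker → u.ker := fun c => ⟨φ c - s (u (φ c)), by simp [AddMonoidHom.mem_ker, hus]⟩
  have hT : Function.Injective T := fun c c' h => by
    have h1 : φ c = φ c' + s (u (φ c) - u (φ c')) := by
      have := congrArg Subtype.val h
      simp only [T] at this
      rw [← sub_eq_zero] at this ⊢
      rw [← this, map_sub]
      abel
    obtain ⟨y', hy⟩ := hφs c' (u (φ c) - u (φ c'))
    have h2 := hφ (h1.trans hy)
    have h3 := congrArg u h2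
    rw [map_add, hus, c.2, c'.2, zero_add] at h3
    rw [← h3, map_zero, add_zero] at h2
    exact Subtype.ext h2
  refine Fintype.sum_bijective T (Finite.injective_iff_bijective.1 hT) _ _ fun c => ?_
  have := hg (φ c) (-u (φ c))
  rw [map_neg, ← sub_eq_add_neg] at this
  exact this.symm

-- The value at `s x` has trivial `p`-th power, while Fermat says that the `p`-th power is the value
-- itself.
omit he in
theorem _root_.mul_eq_one_of_map_add {χ : A → ZMod p} (h0 : χ 0 = 1)
    (hadd : ∀ a b, χ (a + b) = χ a * χ b) (x : ZMod p) : χ (s x) = 1 := by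
  have h : ∀ k : ℕ, χ (k • s x) = χ (s x) ^ k := fun k => by
    induction k with
    | zero => simp [h0]
    | succ k ih => rw [succ_nsmul, hadd, ih, pow_succ]
  have := h p
  rw [← map_nsmul, nsmul_eq_mul, CharP.cast_eq_zero, zero_mul, map_zero, h0,
    ZMod.pow_card] at this
  exact this.symm

/-- The defect `f a b = u (a ∘ b) - u a - β a * u b` is a 2-cocycle with values in `ℤ/p` twisted by
`β`. It does not change when `b` moves by the image of `s`, so it can be averaged over `u.ker`,
whose order is prime to `p`. This makes `f` a coboundary of the average `-H`, and `H` is a crossed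
homomorphism on the abelian group `A`, so that its coboundary is zero. -/
theorem map_mul_coordinate [Finite A] (hus : ∀ x, u (s x) = x)
    (hker : (Nat.card u.ker).Coprime p) {β : A → ZMod p} (h0 : β 0 = 1)
    (hadd : ∀ a b, β (a + b) = β a * β b)
    (hmul : ∀ a b, β (e.symm (e a * e b)) = β a * β b)
    (hconj : ∀ a x, e a * e (s x) = e (s (β a * x)) * e a)
    (hadds : ∀ a x, e (a + s x) = e (s x) * e a) (a b : A) :
    u (e.symm (e a * e b)) = u a + β a * u b := by
  classical
  have := Fintype.ofFinite u.ker
  have hne : ∀ a, β a ≠ 0 := fun a h => by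
    have := hadd a (-a)
    rw [add_neg_cancel, h0, h, zero_mul] at this
    exact one_ne_zero this
  have hconj' : ∀ a x, e (s x) * e a = e a * e (s ((β a)⁻¹ * x)) := fun a x => by
    rw [hconj, mul_inv_cancel_left₀ (hne a)]
  have hlams : ∀ a x, he.lam a (e (s x)) = e (s ((β a)⁻¹ * x)) := fun a x => by
    have := he.apply_add a (s x)
    rw [hadds, hconj'] at this
    exact (mul_left_cancel this).symm
  set L : A → A → A := fun a b => e.symm (he.lam a (e b)) with hL
  have heL : ∀ a b, e (L a b) = he.lam a (e b) := fun a b => e.apply_symm_apply _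
  set O : A → A → A := fun a b => e.symm (e a * e b) with hO
  have heO : ∀ a b, e (O a b) = e a * e b := fun a b => e.apply_symm_apply _
  have hLs : ∀ a b x, L a (b + s x) = L a b + s ((β a)⁻¹ * x) := fun a b x => e.injective (by
    rw [hadds, heL, heL, hadds, map_mul, hlams])
  have hOs : ∀ a b x, O a (b + s x) = O a b + s (β a * x) := fun a b x => e.injective (by
    rw [hadds, heO, heO, hadds, ← mul_assoc, hconj, mul_assoc])
  have hOL : ∀ a b, O a (L a b) = a + b := fun a b => e.injective (by
    rw [heO, heL, he.apply_add])
  have hOinj : ∀ a, Function.Injective (O a) := fun a b c h => by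
    have := congrArg e h
    rw [heO, heO] at this
    exact e.injective (mul_left_cancel this)
  have hLinj : ∀ a, Function.Injective (L a) := fun a b c h =>
    e.injective ((he.lam a).injective (e.symm.injective h))
  set f : A → A → ZMod p := fun a b => u (O a b) - u a - β a * u b with hf
  have hfs : ∀ a b x, f a (b + s x) = f a b := fun a b x => by
    simp only [hf, hOs, map_add, hus]; ring
  have hcocycle : ∀ a b c, f a b + f (O a b) c = β a * f b c + f a (O b c) := fun a b c => by
    have hassoc : O (O a b) c = O a (O b c) := e.injective (by simp only [heO, mul_assoc])
    have hβ : β (O a b) = β a * β b := hmul a b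
    simp only [hf, hassoc, hβ]; ring
  have hsumO : ∀ a b, ∑ c : u.ker, f a (O b c) = ∑ c : u.ker, f a c := fun a b =>
    sum_ker_comp hus (hOinj b) (fun d y => ⟨(β b)⁻¹ * y, by
      rw [hOs, mul_inv_cancel_left₀ (hne b)]⟩) (hfs a)
  have hsumL : ∀ (g : A → ZMod p), (∀ b y, g (b + s y) = g b) → ∀ b,
      ∑ c : u.ker, g (L b c) = ∑ c : u.ker, g c := fun g hg b =>
    sum_ker_comp hus (hLinj b) (fun d y => ⟨β b * y, by
      rw [hLs, inv_mul_cancel_left₀ (hne b)]⟩) hg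
  set h : A → A → ZMod p := fun a b => β a * u (L a b) - u b with hh
  have hhs : ∀ a b x, h a (b + s x) = h a b := fun a b x => by
    simp only [hh, hLs, map_add, hus, mul_add, mul_inv_cancel_left₀ (hne a)]; ring
  have hfh : ∀ a b, f a (L a b) = - h a b := fun a b => by
    simp only [hf, hh, hOL, map_add]; ring
  have hLL : ∀ a b c, L (a + b) c = L a (L b c) := fun a b c => e.injective (by
    simp only [heL, he.lam_add])
  have hhadd : ∀ a b c, h (a + b) c = β b * h a (L b c) + h b c := fun a b c => by
    simp only [hh, hLL, hadd]; ring
  set H : A → ZMod p := fun a => ∑ c : u.ker, h a c with hH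
  have hHadd : ∀ a b, H (a + b) = β b * H a + H b := fun a b => by
    simp only [hH, hhadd, Finset.sum_add_distrib, ← Finset.mul_sum]
    rw [hsumL _ (hhs a)]
  have hF : ∀ a, ∑ c : u.ker, f a c = - H a := fun a => by
    rw [← hsumL _ (hfs a) a]
    simp only [hfh, Finset.sum_neg_distrib, hH]
  -- A crossed homomorphism on an abelian group with values twisted by a nontrivial character is
  -- principal. For trivial `β`, `H` is a homomorphism, which vanishes because `s 1` acts trivially.
  obtain ⟨κ, hκ⟩ : ∃ κ, ∀ a, H a = κ * (β a - 1) := by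
    by_cases hβ : ∀ a, β a = 1
    · refine ⟨0, fun a => ?_⟩
      have hs1 : H (s 1) = 0 := by
        refine Finset.sum_eq_zero fun c _ => ?_
        have : L (s 1) c = c := e.injective (by
          have h1 := he.apply_add (s 1) c
          rw [add_comm, hadds] at h1
          rw [heL]; exact (mul_left_cancel h1).symm)
        simp only [hh, this, hβ, one_mul, sub_self]
      let Hh : A →+ ZMod p := AddMonoidHom.mk' H fun a b => by rw [hHadd, hβ, one_mul]
      have := AddMonoidHom.eq_mul_of_coprime_ker hus hker Hh a
      have h1 : H a = H (s 1) * u a := this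
      rw [h1, hs1, zero_mul, zero_mul]
    · push Not at hβ
      obtain ⟨b, hb⟩ := hβ
      -- The constant is forced by comparing `H (a + b)` with `H (b + a)`.
      refine ⟨H b / (β b - 1), fun a => ?_⟩
      have h1 := hHadd a b
      rw [add_comm, hHadd] at h1
      field_simp [sub_ne_zero.2 hb]
      linear_combination -h1
  have hcard : ((Fintype.card u.ker : ℕ) : ZMod p) ≠ 0 := fun h => by
    rw [ZMod.natCast_eq_zero_iff, ← Nat.card_eq_fintype_card] at h
    exact (Fact.out : p.Prime).one_lt.ne' (Nat.dvd_one.1 (hker ▸ Nat.dvd_gcd h dvd_rfl))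
  have hsum : (Fintype.card u.ker : ZMod p) * f a b + ∑ c : u.ker, f (O a b) c =
      β a * ∑ c : u.ker, f b c + ∑ c : u.ker, f a c := by
    rw [← hsumO a b, Finset.mul_sum, ← Finset.sum_add_distrib]
    simp only [← hcocycle, Finset.sum_add_distrib]
    simp
  have hβ : β (O a b) = β a * β b := hmul a b
  rw [hF, hF, hF, hκ, hκ, hκ, hβ] at hsum
  have hf0 : f a b = 0 := by
    refine (mul_eq_zero.1 ?_).resolve_left hcard
    linear_combination hsum
  simp only [hf] at hf0
  linear_combination hf0

end Prime

end IsBraceEquiv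

/-! ### Groups of squarefree order -/

section GroupTheory

variable {G : Type*} [Group G] [Finite G] {p : ℕ} [Fact p.Prime]

/-- If `p` divides the order of the commutator subgroup of a group of squarefree order, then the
group has a characteristic subgroup of order `p`. -/
theorem exists_char_subgroup (hG : Squarefree (Nat.card G)) (hp : p ∣ Nat.card (commutator G)) :
    ∃ T : Subgroup G, Nat.card T = p ∧ ∀ (φ : MulAut G), ∀ g ∈ T, φ g ∈ T := by
  classical
  have := IsZGroup.of_squarefree hG
  have hc : IsCyclic (commutator G) := IsZGroup.isCyclic_commutator G
  obtain ⟨z, hz⟩ := exists_prime_orderOf_dvd_card' p hp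
  have hcard : Nat.card (Subgroup.zpowers z) = p := by rw [Nat.card_zpowers, hz]
  -- The commutator subgroup is cyclic, so its subgroup of order `p` consists of all solutions of `w
  -- ^ p = 1`, a description stable under automorphisms.
  have hmem : ∀ w : commutator G, w ^ p = 1 → w ∈ Subgroup.zpowers z := by
    have := Fintype.ofFinite (commutator G)
    have hle := IsCyclic.card_pow_eq_one_le (α := commutator G) (Fact.out : p.Prime).pos
    have hsub : (Finset.univ.filter fun w : commutator G => w ∈ Subgroup.zpowers z) ⊆
        Finset.univ.filter fun w : commutator G => w ^ p = 1 := by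
      intro w hw
      simp only [Finset.mem_filter, Finset.mem_univ, true_and] at hw ⊢
      rw [← hcard]
      exact congrArg Subtype.val (pow_card_eq_one' (x := (⟨w, hw⟩ : Subgroup.zpowers z)))
    have heq := Finset.eq_of_subset_of_card_le hsub (hle.trans (by
      rw [← Fintype.card_subtype, ← Nat.card_eq_fintype_card]
      exact hcard.ge))
    intro w hw
    have : w ∈ Finset.univ.filter fun w : commutator G => w ^ p = 1 := by simpa using hw
    rw [← heq] at this
    simpa using this
  refine ⟨(Subgroup.zpowers z).map (commutator G).subtype, ?_, ?_⟩
  · rw [← hcard]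
    exact Nat.card_congr ((Subgroup.zpowers z).equivMapOfInjective _
      (commutator G).subtype_injective).symm.toEquiv
  · rintro φ _ ⟨w, hw, rfl⟩
    have hchar : ∀ g ∈ commutator G, φ g ∈ commutator G := fun g hg => by
      have : (commutator G).map φ.toMonoidHom = commutator G :=
        Subgroup.characteristic_iff_map_eq.1 inferInstance φ
      rw [← this]
      exact ⟨g, hg, rfl⟩
    refine ⟨⟨φ w, hchar _ w.2⟩, hmem _ (Subtype.ext ?_), rfl⟩
    have hwp : w ^ p = 1 := by
      rw [← hcard]
      exact congrArg Subtype.val (pow_card_eq_one' (x := (⟨w, hw⟩ : Subgroup.zpowers z)))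
    have := congrArg φ (congrArg Subtype.val hwp)
    simpa using this

/-- If `p` divides the order of a group of squarefree order but not the order of its commutator
subgroup, then the homomorphisms to `ℤ/p` are the multiples of a surjective one. -/
theorem exists_surjective_hom (hG : Squarefree (Nat.card G)) (hpG : p ∣ Nat.card G)
    (hp : ¬ p ∣ Nat.card (commutator G)) :
    ∃ r : G →* Multiplicative (ZMod p), Function.Surjective r ∧
      ∀ φ : G →* Multiplicative (ZMod p), ∃ c, ∀ g, (φ g).toAdd = c * (r g).toAdd := by
  have := IsZGroup.of_squarefree hG
  -- The abelianization is cyclic, so a homomorphism to `ℤ/p` is determined by the image of a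
  -- generator.
  have hc : IsCyclic (Abelianization G) := IsZGroup.isCyclic_abelianization
  have hpm : p ∣ Nat.card (Abelianization G) := by
    rw [Subgroup.card_eq_card_quotient_mul_card_subgroup (commutator G)] at hpG
    exact ((Fact.out : p.Prime).dvd_mul.1 hpG).resolve_right hp
  let m := Nat.card (Abelianization G)
  let E : Multiplicative (ZMod m) ≃* Abelianization G := zmodCyclicMulEquiv hc
  let ρ : Multiplicative (ZMod m) →* Multiplicative (ZMod p) :=
    (ZMod.castHom hpm (ZMod p)).toAddMonoidHom.toMultiplicative
  have hρ : Function.Surjective ρ := fun x => by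
    obtain ⟨y, hy⟩ := ZMod.castHom_surjective hpm x.toAdd
    exact ⟨Multiplicative.ofAdd y, hy⟩
  refine ⟨(ρ.comp E.symm.toMonoidHom).comp Abelianization.of,
    (hρ.comp E.symm.surjective).comp Quotient.mk_surjective, fun φ => ?_⟩
  let ψ : ZMod m →+ ZMod p := ((Abelianization.lift φ).comp E.toMonoidHom).toAdditive
  have hψ : ∀ x : ZMod m, ψ x = ψ 1 * ZMod.castHom hpm (ZMod p) x := fun x => by
    obtain ⟨k, rfl⟩ := ZMod.natCast_zmod_surjective x
    rw [← nsmul_one k, map_nsmul, map_nsmul, RingHom.map_one, nsmul_eq_mul, nsmul_eq_mul, mul_one,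
      mul_comm]
  refine ⟨ψ 1, fun g => ?_⟩
  have := hψ (E.symm (Abelianization.of g)).toAdd
  refine Eq.trans ?_ this
  change (φ g).toAdd = (Abelianization.lift φ (E (E.symm (Abelianization.of g)))).toAdd
  rw [MulEquiv.apply_symm_apply, Abelianization.lift_apply_of]

end GroupTheory

/-! ### The two cases for a prime and the commutator subgroup -/

namespace IsBraceEquiv

variable {A G : Type*} [AddCommGroup A] [Group G] [Finite A] {e : A ≃ G} (he : IsBraceEquiv e)
variable {p : ℕ} [Fact p.Prime] {s : ZMod p →+ A} {u : A →+ ZMod p}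
include he

/-- Each `lam a` multiplies the surjection `r : G → ℤ/p` by a nonzero scalar `α a`. If all these
scalars are `1`, then `r ∘ e` is additive on `A`, hence a nonzero multiple of `u`, and `u` inherits
multiplicativity from `r`. -/
theorem map_mul_coordinate_of_not_dvd_commutator (hus : ∀ x, u (s x) = x)
    (hker : (Nat.card u.ker).Coprime p) (hG : Squarefree (Nat.card G)) (hpG : p ∣ Nat.card G)
    (hp : ¬ p ∣ Nat.card (commutator G)) (a b : A) :
    u (e.symm (e a * e b)) = u a + u b := by
  have : Finite G := Finite.of_equiv A e
  obtain ⟨r, hr, hmul⟩ := exists_surjective_hom hG hpG hp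
  choose α hα using fun a => hmul (r.comp (he.lam a).toMonoidHom)
  have hα' : ∀ a g, (r (he.lam a g)).toAdd = α a * (r g).toAdd := hα
  have hα0 : ∀ a, α a ≠ 0 := fun a h => by
    obtain ⟨g, hg⟩ := hr (Multiplicative.ofAdd 1)
    obtain ⟨g', rfl⟩ := (he.lam a).surjective g
    have := hα' a g'
    rw [hg, h, zero_mul] at this
    exact one_ne_zero this
  have hsurj : ∀ x, ∃ a, (r (e a)).toAdd = x := fun x => by
    obtain ⟨g, hg⟩ := hr (Multiplicative.ofAdd x)
    exact ⟨e.symm g, by rw [e.apply_symm_apply, hg]; rfl⟩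
  have hadd : ∀ a b, (r (e (a + b))).toAdd = (r (e a)).toAdd + α a * (r (e b)).toAdd :=
    fun a b => by rw [he.apply_add, map_mul, toAdd_mul, hα']
  have hα1 : ∀ a, α a = 1 := by
    by_contra! h
    obtain ⟨a₀, ha₀⟩ := h
    have hk : ∀ b, (r (e b)).toAdd * (α a₀ - 1) = (r (e a₀)).toAdd * (α b - 1) := fun b => by
      have h1 := hadd a₀ b
      rw [add_comm a₀, hadd] at h1
      linear_combination -h1
    have hne : α a₀ - 1 ≠ 0 := sub_ne_zero.2 ha₀
    -- By `hk`, `r ∘ e` is a multiple of `α - 1`. At this value of `r (e b)` either that multiple is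
    -- zero, against surjectivity of `r`, or `α b = 0`.
    obtain ⟨b, hb⟩ := hsurj (-((r (e a₀)).toAdd / (α a₀ - 1)))
    have h1 := hk b
    rw [hb, neg_mul, div_mul_cancel₀ _ hne] at h1
    have h2 : (r (e a₀)).toAdd * α b = 0 := by linear_combination -h1
    rcases mul_eq_zero.1 h2 with h3 | h3
    · obtain ⟨c, hc⟩ := hsurj 1
      have := hk c
      rw [hc, h3, one_mul, zero_mul] at this
      exact hne this
    · exact hα0 b h3
  let R : A →+ ZMod p := AddMonoidHom.mk' (fun a => (r (e a)).toAdd) fun a b => by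
    rw [hadd, hα1, one_mul]
  have hR : ∀ a, (r (e a)).toAdd = R (s 1) * u a :=
    fun a => AddMonoidHom.eq_mul_of_coprime_ker hus hker R a
  have hR0 : R (s 1) ≠ 0 := fun h => by
    obtain ⟨c, hc⟩ := hsurj 1
    rw [hR, h, zero_mul] at hc
    exact zero_ne_one hc
  refine mul_left_cancel₀ hR0 ?_
  rw [← hR, e.apply_symm_apply, map_mul, toAdd_mul, hR, hR]
  ring

/-- Since `T` is stable under every `lam a`, its preimage in `A` is a subgroup, of order `p`. The
image of `s` is the only such subgroup, its complement `u.ker` having order prime to `p`. -/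
theorem mem_char_subgroup_iff (hus : ∀ x, u (s x) = x)
    (hker : (Nat.card u.ker).Coprime p) {T : Subgroup G} (hT : Nat.card T = p)
    (hchar : ∀ (φ : MulAut G), ∀ g ∈ T, φ g ∈ T) (g : G) : g ∈ T ↔ ∃ x, e (s x) = g := by
  have : Finite G := Finite.of_equiv A e
  let S : AddSubgroup A :=
    { carrier := {a | e a ∈ T}
      zero_mem' := by simp [he.apply_zero]
      add_mem' := fun {a b} ha hb => by
        simp only [Set.mem_ofPred_eq] at *
        rw [he.apply_add]
        exact T.mul_mem ha (hchar _ _ hb)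
      neg_mem' := fun {a} ha => by
        simp only [Set.mem_ofPred_eq] at *
        have h1 := he.apply_add a (-a)
        rw [add_neg_cancel, he.apply_zero] at h1
        have h2 : he.lam a (e (-a)) ∈ T := by
          rw [eq_inv_of_mul_eq_one_right h1.symm]
          exact T.inv_mem ha
        have h3 := hchar (he.lam (-a)) _ h2
        rwa [← he.lam_add, neg_add_cancel, he.lam_zero] at h3 }
  have hS : Nat.card S = p := by
    rw [← hT]
    exact Nat.card_congr (e.subtypeEquiv fun a => Iff.rfl)
  have hle : S ≤ s.range := fun a ha => by
    have h1 : p • a = 0 := by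
      have := card_nsmul_eq_zero' (x := (⟨a, ha⟩ : S))
      rw [hS] at this
      exact congrArg Subtype.val this
    refine ⟨u a, ?_⟩
    have hmem : a - s (u a) ∈ u.ker := by simp [AddMonoidHom.mem_ker, hus]
    have h2 : addOrderOf (a - s (u a)) ∣ p := by
      rw [addOrderOf_dvd_iff_nsmul_eq_zero, nsmul_sub, h1, ← map_nsmul, nsmul_eq_mul,
        CharP.cast_eq_zero, zero_mul, map_zero, sub_zero]
    have h3 : addOrderOf (a - s (u a)) ∣ Nat.card u.ker := by
      have := addOrderOf_dvd_natCard (⟨_, hmem⟩ : u.ker)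
      rwa [← AddSubgroup.addOrderOf_coe] at this
    have h4 := Nat.dvd_gcd h3 h2
    rw [hker, Nat.dvd_one, AddMonoid.addOrderOf_eq_one_iff, sub_eq_zero] at h4
    exact h4.symm
  have hs : Nat.card s.range = p := by
    have hinj : Function.Injective s := fun x y h => by rw [← hus x, h, hus]
    rw [← Nat.card_congr (AddMonoidHom.ofInjective hinj).toEquiv, Nat.card_zmod]
  have heq : S = s.range := AddSubgroup.eq_of_le_of_card_ge hle (by rw [hS, hs])
  constructor
  · intro hg
    have : e.symm g ∈ S := by simpa [S] using hg
    rw [heq] at this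
    obtain ⟨x, hx⟩ := this
    exact ⟨x, by rw [hx, e.apply_symm_apply]⟩
  · rintro ⟨x, rfl⟩
    have : s x ∈ S := heq ▸ ⟨x, rfl⟩
    exact this

/-- The additive group has a characteristic subgroup of order `p`, which must be the image of `e ∘
s`. Automorphisms act on it by scalars, and `lam (s x)` acts trivially on it, which makes `e ∘ s` a
homomorphism. -/
theorem exists_char_coordinate (hus : ∀ x, u (s x) = x)
    (hker : (Nat.card u.ker).Coprime p) (hG : Squarefree (Nat.card G))
    (hp : p ∣ Nat.card (commutator G)) :
    (∀ x y, e (s (x + y)) = e (s x) * e (s y)) ∧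
      ∀ φ : MulAut G, ∃ c : ZMod p, ∀ x, φ (e (s x)) = e (s (c * x)) := by
  have : Finite G := Finite.of_equiv A e
  obtain ⟨T, hT, hchar⟩ := exists_char_subgroup hG hp
  have hmem := he.mem_char_subgroup_iff hus hker hT hchar
  have hcyc : IsCyclic T := isCyclic_of_prime_card hT
  have hpow : ∀ g ∈ T, g ^ p = 1 := fun g hg => by
    have := pow_card_eq_one' (x := (⟨g, hg⟩ : T))
    rw [hT] at this
    exact congrArg Subtype.val this
  have hzpow : ∀ φ : MulAut G, ∃ k : ℤ, ∀ g ∈ T, φ g = g ^ k := fun φ => by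
    obtain ⟨k, hk⟩ := MonoidHom.map_cyclic
      ((φ.toMonoidHom.comp T.subtype).codRestrict T fun g => hchar φ g g.2)
    exact ⟨k, fun g hg => congrArg Subtype.val (hk ⟨g, hg⟩)⟩
  have hlam : ∀ x, ∀ g ∈ T, he.lam (s x) g = g := fun x g hg => by
    obtain ⟨k, hk⟩ := hzpow (he.lam (s x))
    have h1 : ∀ n : ℕ, he.lam (n • s x) g = g ^ (k ^ n) := fun n => by
      induction n with
      | zero => simp [he.lam_zero]
      | succ n ih => rw [succ_nsmul', he.lam_add, ih, map_zpow, hk g hg, ← zpow_mul, pow_succ']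
    have h2 := h1 p
    rw [← map_nsmul, nsmul_eq_mul, CharP.cast_eq_zero, zero_mul, map_zero, he.lam_zero] at h2
    rw [hk g hg]
    conv_rhs => rw [h2]
    -- As `p • s x = 0`, the exponent `k ^ p` acts as the identity; by Fermat it acts as `k`.
    have h3 : (p : ℤ) ∣ k ^ p - k := by
      rw [← ZMod.intCast_zmod_eq_zero_iff_dvd]
      push_cast
      rw [ZMod.pow_card, sub_self]
    obtain ⟨j, hj⟩ := h3
    rw [eq_add_of_sub_eq hj, zpow_add, zpow_mul, zpow_natCast, hpow g hg, one_zpow, one_mul]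
  have hadd : ∀ x y, e (s (x + y)) = e (s x) * e (s y) := fun x y => by
    rw [map_add, he.apply_add, hlam x _ ((hmem _).2 ⟨y, rfl⟩)]
  refine ⟨hadd, fun φ => ?_⟩
  obtain ⟨k, hk⟩ := hzpow φ
  let ν : Multiplicative (ZMod p) →* G :=
    { toFun := fun x => e (s x.toAdd)
      map_one' := by
        change e (s 0) = 1
        rw [map_zero, he.apply_zero]
      map_mul' := fun x y => hadd x.toAdd y.toAdd }
  refine ⟨k, fun x => ?_⟩
  rw [hk _ ((hmem _).2 ⟨x, rfl⟩)]
  have := map_zpow ν (Multiplicative.ofAdd x) k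
  rw [← ofAdd_zsmul, zsmul_eq_mul] at this
  exact this.symm

end IsBraceEquiv

/-! ### The character attached to a prime -/

namespace IsBraceEquiv

variable {A G : Type*} [AddCommGroup A] [Group G] [Finite A] {e : A ≃ G} (he : IsBraceEquiv e)
variable {p : ℕ} [Fact p.Prime] {s : ZMod p →+ A} {u : A →+ ZMod p}
include he

omit [AddCommGroup A] [Group G] he in
/-- If a nontrivial multiplicative character `γ` satisfies `α * (γ b - 1) = γ (f b) - 1`, then
`α = 1`. -/
theorem _root_.eq_one_of_mul_sub_one [AddCommGroup A] {γ : A → ZMod p} (h0 : γ 0 = 1)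
    (hadd : ∀ a b, γ (a + b) = γ a * γ b) {a₀ : A} (ha₀ : γ a₀ ≠ 1) {α : ZMod p} (hα : α ≠ 0)
    {f : A → A} (hf : ∀ b, α * (γ b - 1) = γ (f b) - 1) : α = 1 := by
  classical
  have := Fintype.ofFinite A
  have hne : ∀ a, γ a ≠ 0 := fun a h => by
    have := hadd a (-a)
    rw [add_neg_cancel, h0, h, zero_mul] at this
    exact one_ne_zero this
  let I : Finset (ZMod p) := Finset.univ.image γ
  have hI : ∀ x, x ∈ I ↔ ∃ a, γ a = x := by simp [I]
  -- The image `I` of `γ` is a nontrivial subgroup of the units of `ℤ/p`, so its sum is unchanged by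
  -- multiplication by `γ a₀ ≠ 1`.
  have hsum0 : ∑ x ∈ I, x = 0 := by
    have h1 : ∑ x ∈ I, γ a₀ * x = ∑ x ∈ I, x := by
      refine Finset.sum_nbij (fun x => γ a₀ * x) ?_ ?_ ?_ (fun _ _ => rfl)
      · intro x hx
        obtain ⟨a, rfl⟩ := (hI _).1 hx
        exact (hI _).2 ⟨a₀ + a, hadd _ _⟩
      · intro x _ y _ hxy
        exact mul_left_cancel₀ (hne a₀) hxy
      · intro x hx
        obtain ⟨a, rfl⟩ := (hI _).1 hx
        exact ⟨γ (-a₀ + a), (hI _).2 ⟨_, rfl⟩, by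
          change γ a₀ * γ (-a₀ + a) = γ a
          rw [← hadd, add_neg_cancel_left]⟩
    rw [← Finset.mul_sum] at h1
    have h2 : (γ a₀ - 1) * ∑ x ∈ I, x = 0 := by linear_combination h1
    exact (mul_eq_zero.1 h2).resolve_left (sub_ne_zero.2 ha₀)
  -- The affine map `x ↦ α * (x - 1) + 1` permutes `I`. Summing gives `α * |I| = |I|`, and `0 < |I|
  -- < p`.
  have hsum : ∑ x ∈ I, (α * (x - 1)) = ∑ x ∈ I, (x - 1) := by
    have hmaps : ∀ x ∈ I, α * (x - 1) + 1 ∈ I := fun x hx => by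
      obtain ⟨a, rfl⟩ := (hI _).1 hx
      exact (hI _).2 ⟨f a, by rw [hf]; ring⟩
    have hinj : Set.InjOn (fun x => α * (x - 1) + 1) I := fun x _ y _ hxy => by
      have := mul_left_cancel₀ hα (add_right_cancel hxy)
      linear_combination this
    refine Finset.sum_nbij (fun x => α * (x - 1) + 1) hmaps hinj
      (Finset.surjOn_of_injOn_of_card_le _ hmaps hinj le_rfl) fun x _ => by ring
  have hcard : (I.card : ZMod p) ≠ 0 := fun h => by
    rw [ZMod.natCast_eq_zero_iff] at h
    have h1 : I ⊆ Finset.univ.erase 0 := fun x hx => by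
      obtain ⟨a, rfl⟩ := (hI _).1 hx
      simpa using hne a
    have h2 := Finset.card_le_card h1
    rw [Finset.card_erase_of_mem (Finset.mem_univ _), Finset.card_univ, ZMod.card] at h2
    have h3 : 0 < I.card := Finset.card_pos.2 ⟨γ 0, (hI _).2 ⟨0, rfl⟩⟩
    have h4 := Nat.le_of_dvd h3 h
    have := (Fact.out : p.Prime).pos
    omega
  rw [← Finset.mul_sum, Finset.sum_sub_distrib, hsum0] at hsum
  simp only [Finset.sum_const, nsmul_eq_mul, mul_one] at hsum
  have h2 : (α - 1) * (I.card : ZMod p) = 0 := by linear_combination -hsum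
  exact sub_eq_zero.1 ((mul_eq_zero.1 h2).resolve_right hcard)

/-- When `p` divides the order of the commutator subgroup, `α` and `β` record the scalars by which
`lam a` and conjugation by `e a` act on the characteristic subgroup of order `p`. Adding `s x` to
`a` is left multiplication by `e (s (α a * β a * x))`. Either `γ = α * β` is trivial and
`map_mul_coordinate` applies, or `α` is trivial and it applies to the opposite group, which accounts
for the two forms. -/
theorem exists_character (hus : ∀ x, u (s x) = x)
    (hker : (Nat.card u.ker).Coprime p) (hG : Squarefree (Nat.card G)) (hpG : p ∣ Nat.card G) :
    ∃ β : A → ZMod p, β 0 = 1 ∧ (∀ a b, β (a + b) = β a * β b) ∧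
      (∀ a b, β (e.symm (e a * e b)) = β a * β b) ∧
      ((∀ a, β a = 1) ∨ ∀ a x, e a * e (s x) = e (s (β a * x)) * e a) ∧
      ((∀ a b, u (e.symm (e a * e b)) = u a + β a * u b) ∨
        ∀ a b, u (e.symm (e a * e b)) = (β b)⁻¹ * u a + u b) := by
  by_cases hp : p ∣ Nat.card (commutator G)
  swap
  · exact ⟨fun _ => 1, rfl, by simp, by simp, .inl fun _ => rfl, .inl fun a b => by
      rw [he.map_mul_coordinate_of_not_dvd_commutator hus hker hG hpG hp, one_mul]⟩
  obtain ⟨hν, hφ⟩ := he.exists_char_coordinate hus hker hG hp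
  have hνinj : ∀ {x y}, e (s x) = e (s y) → x = y := fun {x y} h => by
    rw [← hus x, e.injective h, hus]
  choose c hc using hφ
  have hcmul : ∀ φ ψ, c (φ * ψ) = c φ * c ψ := fun φ ψ => by
    have h1 := hc (φ * ψ) 1
    rw [MulAut.mul_apply, hc, hc] at h1
    simpa using (hνinj h1).symm
  have hcone : c 1 = 1 := by
    have h1 := hc 1 1
    rw [MulAut.one_apply] at h1
    simpa using (hνinj h1).symm
  have hcne : ∀ φ, c φ ≠ 0 := fun φ h => by
    have := hcmul φ φ⁻¹
    rw [mul_inv_cancel, hcone, h, zero_mul] at this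
    exact one_ne_zero this
  have hlamadd : ∀ a b, he.lam (a + b) = he.lam a * he.lam b := fun a b =>
    MulEquiv.ext fun x => he.lam_add a b x
  set α : A → ZMod p := fun a => c (he.lam a) with hα
  set β : A → ZMod p := fun a => c (MulAut.conj (e a)) with hβ
  have hα0 : α 0 = 1 := by
    have : he.lam 0 = 1 := MulEquiv.ext fun x => he.lam_zero x
    rw [hα]; simp only [this, hcone]
  have hαadd : ∀ a b, α (a + b) = α a * α b := fun a b => by simp only [hα, hlamadd, hcmul]
  have hαs : ∀ x, α (s x) = 1 := mul_eq_one_of_map_add hα0 hαadd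
  have hβ0 : β 0 = 1 := by simp only [hβ, he.apply_zero, map_one, hcone]
  have hβmul : ∀ a b, β (e.symm (e a * e b)) = β a * β b := fun a b => by
    simp only [hβ, e.apply_symm_apply, map_mul, hcmul]
  -- Conjugation by `lam a x` is the `lam a`-conjugate of conjugation by `x`, and scalars commute.
  have hβlam : ∀ a b, β (e.symm (he.lam a (e b))) = β b := fun a b => by
    have h1 : he.lam a * MulAut.conj (e b) = MulAut.conj (he.lam a (e b)) * he.lam a := by
      ext x; simp
    have h2 := congrArg c h1
    rw [hcmul, hcmul, mul_comm] at h2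
    simp only [hβ, e.apply_symm_apply]
    exact (mul_right_cancel₀ (hcne _) h2).symm
  have hβadd : ∀ a b, β (a + b) = β a * β b := fun a b => by
    rw [← hβlam a b, ← hβmul, e.apply_symm_apply, ← he.apply_add, e.symm_apply_apply]
  have hconj : ∀ a x, e a * e (s x) = e (s (β a * x)) * e a := fun a x => by
    rw [← hc, MulAut.conj_apply, inv_mul_cancel_right]
  have hβne : ∀ a, β a ≠ 0 := fun a => hcne _
  have hadds : ∀ a x, e (a + s x) = e (s (α a * β a * x)) * e a := fun a x => by
    rw [he.apply_add, hc, hconj]; congr 3; simp only [hα]; ring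
  set γ : A → ZMod p := fun a => α a * β a with hγ
  have hγ0 : γ 0 = 1 := by simp only [hγ, hα0, hβ0, mul_one]
  have hγadd : ∀ a b, γ (a + b) = γ a * γ b := fun a b => by
    simp only [hγ, hαadd, hβadd]; ring
  have hlams : ∀ a, he.lam (s 1) (e a) = e (s (γ a - 1)) * e a := fun a => by
    have h1 := he.apply_add (s 1) a
    rw [add_comm, hadds, mul_one] at h1
    have h2 : e (s (γ a)) = e (s 1) * e (s (γ a - 1)) := by rw [← hν]; congr 2; ring
    rw [h2, mul_assoc] at h1
    exact (mul_left_cancel h1).symm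
  -- Apply the automorphism `lam (s 1)` to the product `e a * e b`, using `hlams` for each factor,
  -- and compare the translations by the subgroup of order `p`.
  have hγop : ∀ a b, γ (e.symm (e a * e b)) - 1 = γ a - 1 + β a * (γ b - 1) := fun a b => by
    have h1 := hlams (e.symm (e a * e b))
    rw [e.apply_symm_apply, map_mul, hlams, hlams, mul_assoc, ← mul_assoc (e a), hconj, mul_assoc,
      ← mul_assoc, ← hν] at h1
    exact (hνinj (mul_right_cancel h1)).symm
  -- With `b` replaced by its image under `lam a`, the product becomes `a + b`, on which `γ` is
  -- multiplicative.
  have hγlam : ∀ a b, α a * (γ b - 1) = γ (e.symm (he.lam a (e b))) - 1 := fun a b => by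
    have h1 := hγop a (e.symm (he.lam a (e b)))
    rw [e.apply_symm_apply, ← he.apply_add, e.symm_apply_apply, hγadd] at h1
    refine mul_left_cancel₀ (hβne a) ?_
    rw [← mul_assoc, mul_comm (β a)]
    linear_combination h1
  by_cases hγ1 : ∀ a, γ a = 1
  · refine ⟨β, hβ0, hβadd, hβmul, .inr hconj, .inl fun a b => ?_⟩
    refine he.map_mul_coordinate hus hker hβ0 hβadd hβmul hconj (fun a x => ?_) a b
    rw [hadds, show α a * β a = 1 from hγ1 a, one_mul]
  · push Not at hγ1
    obtain ⟨a₀, ha₀⟩ := hγ1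
    have hα1 : ∀ a, α a = 1 := fun a =>
      eq_one_of_mul_sub_one hγ0 hγadd ha₀ (hcne _) (hγlam a)
    refine ⟨β, hβ0, hβadd, hβmul, .inr hconj, .inr fun a b => ?_⟩
    have := he.op.map_mul_coordinate hus hker (β := fun a => (β a)⁻¹) (by simp [hβ0])
      (fun a b => by simp [hβadd, mul_comm]) (fun a b => by
        have := hβmul b a
        simp only [Equiv.symm_trans_apply, Equiv.trans_apply, MulOpposite.opEquiv_apply,
          MulOpposite.opEquiv_symm_apply, MulOpposite.unop_mul, MulOpposite.unop_op, this]
        rw [mul_inv_rev]) (fun a x => by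
        have := hconj a ((β a)⁻¹ * x)
        rw [mul_inv_cancel_left₀ (hβne a)] at this
        simp only [Equiv.trans_apply, MulOpposite.opEquiv_apply, ← MulOpposite.op_mul, this])
      (fun a x => by
        simp only [Equiv.trans_apply, MulOpposite.opEquiv_apply, ← MulOpposite.op_mul]
        rw [hadds, hα1, one_mul, hconj]) b a
    simp only [Equiv.symm_trans_apply, Equiv.trans_apply, MulOpposite.opEquiv_apply,
      MulOpposite.opEquiv_symm_apply, MulOpposite.unop_mul, MulOpposite.unop_op] at this
    rw [this, add_comm]

end IsBraceEquiv

theorem AddChar.map_sum_eq_prod {A M ι : Type*} [AddCommMonoid A] [CommMonoid M]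
    (χ : AddChar A M) (s : Finset ι) (g : ι → A) : χ (∑ i ∈ s, g i) = ∏ i ∈ s, χ (g i) :=
  map_prod χ.toMonoidHom (fun i => Multiplicative.ofAdd (g i)) s

/-! ### Brace actions as families of characters -/

section Parameters

variable {ι : Type*} [Fintype ι] [DecidableEq ι] (p : ι → ℕ)

/-- Pairs of characters `(a i, b i)` for which
`(σ ∘ ρ) i = b i ρ * σ i + a i σ * ρ i` is the additive operation of a skew brace. -/
structure IsBraceParam (f : ∀ i, AddChar (∀ i, ZMod (p i)) (ZMod (p i)) ×
    AddChar (∀ i, ZMod (p i)) (ZMod (p i))) : Prop where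
  eq_one : ∀ i, (f i).1 = 1 ∨ (f i).2 = 1
  single : ∀ i j, f i ≠ 1 → ∀ x, (f j).1 (Pi.single i x) = 1 ∧ (f j).2 (Pi.single i x) = 1

variable {p}

/-- The action given by a family of pairs of characters. -/
def paramAct (f : ∀ i, AddChar (∀ i, ZMod (p i)) (ZMod (p i)) ×
    AddChar (∀ i, ZMod (p i)) (ZMod (p i))) (σ ρ : ∀ i, ZMod (p i)) : ∀ i, ZMod (p i) :=
  fun i => (f i).1 (-σ) * ρ i - ((f i).2 ρ - 1) * σ i

theorem AddChar.eq_of_single {R : Type*} [CommRing R] (χ : AddChar (∀ i, ZMod (p i)) R)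
    {σ ρ : ∀ i, ZMod (p i)} (h : ∀ i, σ i = ρ i ∨ ∀ x, χ (Pi.single i x) = 1) : χ σ = χ ρ := by
  have h1 : χ (σ - ρ) = 1 := by
    rw [← Finset.univ_sum_single (σ - ρ), AddChar.map_sum_eq_prod]
    refine Finset.prod_eq_one fun i _ => ?_
    rcases h i with hi | hi
    · simp [hi]
    · exact hi _
  rw [← sub_add_cancel σ ρ, AddChar.map_add_eq_mul, h1, one_mul]

namespace IsBraceParam

variable {f : ∀ i, AddChar (∀ i, ZMod (p i)) (ZMod (p i)) ×
    AddChar (∀ i, ZMod (p i)) (ZMod (p i))} (hf : IsBraceParam p f)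
include hf

theorem eq_of_agree {σ ρ : ∀ i, ZMod (p i)} (h : ∀ i, f i = 1 → σ i = ρ i) (j : ι) :
    (f j).1 σ = (f j).1 ρ ∧ (f j).2 σ = (f j).2 ρ :=
  ⟨AddChar.eq_of_single _ fun i => (eq_or_ne (f i) 1).imp (h i) fun hi x => (hf.single i j hi x).1,
    AddChar.eq_of_single _ fun i => (eq_or_ne (f i) 1).imp (h i) fun hi x => (hf.single i j hi x).2⟩

/-- The action changes only coordinates `i` with `f i ≠ 1`, and no character of the family sees
those coordinates. -/
theorem map_act (σ ρ : ∀ i, ZMod (p i)) (j : ι) :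
    (f j).1 (paramAct f σ ρ) = (f j).1 ρ ∧ (f j).2 (paramAct f σ ρ) = (f j).2 ρ :=
  hf.eq_of_agree (fun i hi => by simp [paramAct, hi]) j

omit [Fintype ι] in
theorem single_self (i : ι) (x : ZMod (p i)) :
    (f i).1 (Pi.single i x) = 1 ∧ (f i).2 (Pi.single i x) = 1 := by
  rcases eq_or_ne (f i) 1 with hi | hi
  · simp [hi]
  · exact hf.single i i hi x

theorem act_add (σ τ ρ : ∀ i, ZMod (p i)) :
    paramAct f (σ + τ) ρ = paramAct f σ (paramAct f τ ρ) := by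
  funext i
  simp only [paramAct, Pi.add_apply]
  rw [(hf.map_act τ ρ i).2, neg_add, AddChar.map_add_eq_mul]
  rcases hf.eq_one i with h | h <;> simp only [h, AddChar.one_apply] <;> ring

theorem act_op (σ ρ τ : ∀ i, ZMod (p i)) : paramAct f σ (ρ + paramAct f (-ρ) τ) =
    paramAct f σ ρ + paramAct f (-paramAct f σ ρ) (paramAct f σ τ) := by
  have hop : ∀ ρ τ : ∀ i, ZMod (p i), ρ + paramAct f (-ρ) τ =
      fun i => (f i).2 τ * ρ i + (f i).1 ρ * τ i := fun ρ τ => by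
    funext i
    simp only [paramAct, Pi.add_apply, Pi.neg_apply, neg_neg]
    ring
  have hchar : ∀ (ρ τ : ∀ i, ZMod (p i)) i,
      (f i).2 (fun i => (f i).2 τ * ρ i + (f i).1 ρ * τ i) = (f i).2 ρ * (f i).2 τ :=
    fun ρ τ i => by
      rw [← AddChar.map_add_eq_mul]
      exact (hf.eq_of_agree (fun j hj => by simp [hj]) i).2
  rw [hop, hop]
  funext i
  rw [(hf.map_act σ ρ i).1, (hf.map_act σ τ i).2]
  simp only [paramAct]
  rw [hchar]
  rcases hf.eq_one i with h | h <;> simp only [h, AddChar.one_apply] <;> ring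

theorem isBraceAction : IsBraceAction (Γ := Multiplicative (∀ i, ZMod (p i))) (paramAct f) where
  one_act ρ := by
    funext i
    change (f i).1 (-0) * ρ i - ((f i).2 ρ - 1) * 0 = ρ i
    simp
  act_one σ := by
    funext i
    change (f i).1 (-Multiplicative.toAdd σ) * 0 - ((f i).2 0 - 1) * σ i = 0
    simp
  mul_act := hf.act_add
  compat := hf.act_op

end IsBraceParam

-- Both characters at `i` are trivial on the factor `i`, so inserting a unit vector there as one
-- argument isolates the character of the other.
omit [Fintype ι] in
theorem paramAct_injective {f g : ∀ i, AddChar (∀ i, ZMod (p i)) (ZMod (p i)) ×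
    AddChar (∀ i, ZMod (p i)) (ZMod (p i))} (hf : IsBraceParam p f) (hg : IsBraceParam p g)
    (h : paramAct f = paramAct g) : f = g := by
  have key : ∀ σ ρ i, (f i).1 (-σ) * ρ i - ((f i).2 ρ - 1) * σ i =
      (g i).1 (-σ) * ρ i - ((g i).2 ρ - 1) * σ i := fun σ ρ i =>
    congrFun (congrFun (congrFun h σ) ρ) i
  funext i
  refine Prod.ext (DFunLike.ext _ _ fun σ => ?_) (DFunLike.ext _ _ fun ρ => ?_)
  · have := key (-σ) (Pi.single i 1) i
    simpa [(hf.single_self i 1).2, (hg.single_self i 1).2] using this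
  · have := key (-Pi.single i 1) ρ i
    rw [neg_neg, (hf.single_self i 1).1, (hg.single_self i 1).1] at this
    simpa using this

variable [∀ i, Fact (p i).Prime]

omit [DecidableEq ι] in
theorem card_pi_zmod : Nat.card (∀ i, ZMod (p i)) = ∏ i, p i := by
  rw [Nat.card_pi]; simp

omit [Fintype ι] [DecidableEq ι] in
theorem squarefree_prod_apply (hp : Function.Injective p) (S : Finset ι) :
    Squarefree (∏ i ∈ S, p i) :=
  Finset.squarefree_prod_of_pairwise_isCoprime
    (fun _ _ _ _ hij => Nat.coprime_iff_isRelPrime.1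
      ((Nat.coprime_primes Fact.out Fact.out).2 (hp.ne hij)))
    fun _ _ => (Fact.out : Nat.Prime _).prime.squarefree

omit [DecidableEq ι] in
theorem squarefree_card_pi_zmod (hp : Function.Injective p) :
    Squarefree (Nat.card (∀ i, ZMod (p i))) := by
  rw [card_pi_zmod]
  exact squarefree_prod_apply hp _

/-- The additive group of the skew brace given by a brace action. -/
def BraceGroup {Γ : Type*} [Group Γ] {π : Γ → Γ → Γ} (_ : IsBraceAction π) : Type _ := Γ

instance {Γ : Type*} [Group Γ] {π : Γ → Γ → Γ} (hπ : IsBraceAction π) : Group (BraceGroup hπ) where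
  mul a b := braceOp (Γ := Γ) π a b
  one := (1 : Γ)
  inv a := braceInv (Γ := Γ) π a
  mul_assoc := hπ.op_assoc
  one_mul := hπ.one_op
  mul_one := hπ.op_one
  inv_mul_cancel := hπ.inv_op

/-- The identity map from the multiplicative group, written additively, to the additive group,
written multiplicatively. -/
def toBraceGroup {A : Type*} [AddCommGroup A] {π : Multiplicative A → Multiplicative A →
    Multiplicative A} (hπ : IsBraceAction π) : A ≃ BraceGroup hπ := Multiplicative.ofAdd

theorem isBraceEquiv_toBraceGroup {A : Type*} [AddCommGroup A]
    {π : Multiplicative A → Multiplicative A → Multiplicative A} (hπ : IsBraceAction π) :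
    IsBraceEquiv (toBraceGroup hπ) where
  apply_zero := rfl
  distrib a x y := by
    have key : ∀ a b : Multiplicative A, toBraceGroup hπ (a.toAdd + b.toAdd) =
        toBraceGroup hπ a.toAdd * toBraceGroup hπ (π a b).toAdd := fun a b => (hπ.op_act a b).symm
    have hop : (toBraceGroup hπ).symm (x * y) = (braceOp π
      (Multiplicative.ofAdd ((toBraceGroup hπ).symm x))
      (Multiplicative.ofAdd ((toBraceGroup hπ).symm y))).toAdd := rfl
    have h1 := key (Multiplicative.ofAdd a) (Multiplicative.ofAdd ((toBraceGroup hπ).symm x))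
    have h2 := key (Multiplicative.ofAdd a) (Multiplicative.ofAdd ((toBraceGroup hπ).symm y))
    have h3 := key (Multiplicative.ofAdd a) (braceOp π
      (Multiplicative.ofAdd ((toBraceGroup hπ).symm x))
      (Multiplicative.ofAdd ((toBraceGroup hπ).symm y)))
    rw [hπ.act_op] at h3
    simp only [toAdd_ofAdd] at h1 h2 h3
    have h4 : ∀ a b : Multiplicative A, toBraceGroup hπ (braceOp π a b).toAdd =
        toBraceGroup hπ a.toAdd * toBraceGroup hπ b.toAdd := fun _ _ => rfl
    rw [hop, h1, h2, h3, h4]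
    group

/-- `exists_character` is applied to every coordinate. The character goes into the first slot of the
pair or, inverted, into the second, according to the form of the operation. -/
theorem exists_paramAct_eq (hp : Function.Injective p)
    {π : Multiplicative (∀ i, ZMod (p i)) → Multiplicative (∀ i, ZMod (p i)) →
      Multiplicative (∀ i, ZMod (p i))} (hπ : IsBraceAction π) :
    ∃ f, IsBraceParam p f ∧ paramAct f = π := by
  classical
  have he := isBraceEquiv_toBraceGroup hπ
  set e := toBraceGroup hπ
  have hsq := squarefree_card_pi_zmod hp
  have hcard : Nat.card (BraceGroup hπ) = Nat.card (∀ i, ZMod (p i)) := (Nat.card_congr e).symm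
  have hker : ∀ i, (Nat.card (Pi.evalAddMonoidHom (fun i => ZMod (p i)) i).ker).Coprime (p i) ∧
      p i ∣ Nat.card (∀ i, ZMod (p i)) := fun i => by
    have hindex : (Pi.evalAddMonoidHom (fun i => ZMod (p i)) i).ker.index = p i := by
      rw [AddSubgroup.index_ker, AddMonoidHom.range_eq_top.2 (Function.surjective_eval i)]
      simp
    have hmul := (Pi.evalAddMonoidHom (fun i => ZMod (p i)) i).ker.card_mul_index
    rw [hindex] at hmul
    rw [← hmul] at hsq ⊢
    exact ⟨Nat.coprime_of_squarefree_mul hsq, dvd_mul_left _ _⟩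
  choose β hβ0 hβadd hβmul hconj hform using fun i =>
    he.exists_character (s := AddMonoidHom.single (fun i => ZMod (p i)) i)
      (u := Pi.evalAddMonoidHom (fun i => ZMod (p i)) i) (fun x => by simp) (hker i).1
      (hcard ▸ hsq) (hcard ▸ (hker i).2)
  let χ : ∀ i, AddChar (∀ i, ZMod (p i)) (ZMod (p i)) := fun i =>
    { toFun := β i, map_zero_eq_one' := hβ0 i, map_add_eq_mul' := hβadd i }
  let f : ∀ i, AddChar (∀ i, ZMod (p i)) (ZMod (p i)) ×
      AddChar (∀ i, ZMod (p i)) (ZMod (p i)) := fun i =>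
    if ∀ a b, Pi.evalAddMonoidHom (fun i => ZMod (p i)) i (e.symm (e a * e b)) =
        Pi.evalAddMonoidHom (fun i => ZMod (p i)) i a +
          β i a * Pi.evalAddMonoidHom (fun i => ZMod (p i)) i b then (χ i, 1) else (1, (χ i)⁻¹)
  have hfχ : ∀ i, f i = (χ i, 1) ∨ f i = (1, (χ i)⁻¹) := fun i => by
    simp only [f]; split_ifs <;> simp
  have hinv : ∀ i a, (χ i)⁻¹ a = (β i a)⁻¹ := fun i a => by
    rw [AddChar.inv_apply, AddChar.map_neg_eq_inv]; rfl
  have hop : ∀ a b i, e.symm (e a * e b) i = (f i).2 b * a i + (f i).1 a * b i := fun a b i => by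
    by_cases h : ∀ a b, Pi.evalAddMonoidHom (fun i => ZMod (p i)) i (e.symm (e a * e b)) =
        Pi.evalAddMonoidHom (fun i => ZMod (p i)) i a +
          β i a * Pi.evalAddMonoidHom (fun i => ZMod (p i)) i b
    · simp only [f, if_pos h, AddChar.one_apply, one_mul]
      exact h a b
    · have h2 := (hform i).resolve_left h a b
      simp only [f, if_neg h, AddChar.one_apply, one_mul, hinv]
      exact h2
  -- A nontrivial `β i` rescales the factor `i` under conjugation. As `β j` is a homomorphism to a
  -- commutative group, it does not see the rescaling by `β i a ≠ 1`, hence is trivial on that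
  -- factor.
  have hχ : ∀ i j, χ i ≠ 1 → ∀ x, χ j (Pi.single i x) = 1 := fun i j hi x => by
    have hi' : ¬ ∀ a, β i a = 1 := fun h => hi (DFunLike.ext _ _ h)
    have hc := (hconj i).resolve_left hi'
    push Not at hi'
    obtain ⟨a, ha⟩ := hi'
    have h1 : ∀ y, β j (Pi.single i y) = β j (Pi.single i (β i a * y)) := fun y => by
      have h2 := hβmul j a (Pi.single i y)
      have h3 := hβmul j (Pi.single i (β i a * y)) a
      have h4 : e a * e (Pi.single i y) = e (Pi.single i (β i a * y)) * e a := hc a y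
      rw [h4, h3, mul_comm] at h2
      refine (mul_left_cancel₀ ?_ h2).symm
      intro h
      have h5 := hβadd j a (-a)
      rw [add_neg_cancel, hβ0, h, zero_mul] at h5
      exact one_ne_zero h5
    -- For this `y`, the difference `β i a * y - y` is `x`.
    have h2 := h1 (x / (β i a - 1))
    have h3 : β i a * (x / (β i a - 1)) = x + x / (β i a - 1) := by
      field_simp [sub_ne_zero.2 ha]
      ring
    rw [h3, Pi.single_add, hβadd] at h2
    refine mul_right_cancel₀ ?_ (h2.symm.trans (one_mul _).symm)
    intro h
    have h5 := hβadd j (Pi.single i (x / (β i a - 1))) (-Pi.single i (x / (β i a - 1)))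
    rw [add_neg_cancel, hβ0, h, zero_mul] at h5
    exact one_ne_zero h5
  refine ⟨f, ⟨fun i => ?_, fun i j hi x => ?_⟩, ?_⟩
  · rcases hfχ i with h | h <;> simp [h]
  · have hi' : χ i ≠ 1 := fun h1 => by
      rcases hfχ i with h | h <;> rw [h, h1] at hi <;> simp at hi
    have := hχ i j hi' x
    rcases hfχ j with h | h
    · simp [h, this]
    · rw [h]
      refine ⟨rfl, ?_⟩
      have h2 : β j (Pi.single i x) = 1 := this
      change (χ j)⁻¹ (Pi.single i x) = 1
      rw [hinv, h2, inv_one]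
  · funext σ ρ i
    have h1 := hop (-σ) ρ i
    have h2 : e.symm (e (-σ) * e ρ) = -σ + (π σ ρ).toAdd := by
      change -σ + (π (Multiplicative.ofAdd (- -σ)) ρ).toAdd = _
      rw [neg_neg]
      rfl
    rw [h2, Pi.add_apply] at h1
    simp only [paramAct]
    rw [Pi.neg_apply] at h1
    change _ = (π σ ρ).toAdd i
    linear_combination -h1

end Parameters

/-! ### Counting characters and parameters -/

theorem AddChar.card_zmod {m : ℕ} [NeZero m] {R : Type*} [CommRing R] [IsCyclic Rˣ] [Finite Rˣ] :
    Nat.card (AddChar (ZMod m) R) = (Nat.card Rˣ).gcd m := by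
  rw [← IsCyclic.card_powMonoidHom_ker]
  have hpow : ∀ u : (powMonoidHom m : Rˣ →* Rˣ).ker, ((u : Rˣ) : R) ^ m = 1 := fun u => by
    have := congrArg Units.val (MonoidHom.mem_ker.1 u.2)
    simpa using this
  refine (Nat.card_congr (Equiv.ofBijective (fun u => zmodChar m (hpow u)) ⟨fun u w h => ?_,
    fun ψ => ?_⟩)).symm
  · have := DFunLike.congr_fun h ((1 : ℕ) : ZMod m)
    simp only [zmodChar_apply', pow_one] at this
    exact Subtype.ext (Units.ext this)
  · have hval : ∀ k : ℕ, ψ k = ψ 1 ^ k := fun k => by rw [← map_nsmul_eq_pow, nsmul_one]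
    let w : Rˣ := ⟨ψ 1, ψ (-1), by rw [← map_add_eq_mul, add_neg_cancel, map_zero_eq_one],
      by rw [← map_add_eq_mul, neg_add_cancel, map_zero_eq_one]⟩
    refine ⟨⟨w, MonoidHom.mem_ker.2 (Units.ext ?_)⟩, DFunLike.ext _ _ fun a => ?_⟩
    · change ψ 1 ^ m = 1
      rw [← hval, ZMod.natCast_self, map_zero_eq_one]
    · rw [zmodChar_apply]
      change ψ 1 ^ a.val = ψ a
      rw [← hval, ZMod.natCast_zmod_val]

section Counting

variable {ι : Type*} [Fintype ι] [DecidableEq ι]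

/-- A character of a finite product is a family of characters of the factors. -/
def AddChar.piEquiv (A : ι → Type*) [∀ i, AddCommMonoid (A i)] (R : Type*) [CommMonoid R] :
    AddChar (∀ i, A i) R ≃ ∀ i, AddChar (A i) R where
  toFun χ i := χ.compAddMonoidHom (AddMonoidHom.single A i)
  invFun ψ :=
    { toFun := fun a => ∏ i, ψ i (a i)
      map_zero_eq_one' := by simp
      map_add_eq_mul' := fun a b => by simp [AddChar.map_add_eq_mul, Finset.prod_mul_distrib] }
  left_inv χ := DFunLike.ext _ _ fun a => by
    conv_rhs => rw [← Finset.univ_sum_single a, AddChar.map_sum_eq_prod]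
    rfl
  right_inv ψ := funext fun i => DFunLike.ext _ _ fun x => by
    change ∏ j, ψ j (Pi.single i x j) = ψ i x
    rw [Finset.prod_eq_single i (fun j _ hj => by simp [Pi.single_eq_of_ne hj]) (by simp)]
    simp

variable (p : ι → ℕ) [∀ i, Fact (p i).Prime]

/-- The number of characters of `ℤ/p` with values in `𝔽_q`. -/
def charCount (q p : ℕ) : ℕ := if q ≡ 1 [MOD p] then p else 1

theorem card_addChar_zmod (q p : ℕ) [Fact q.Prime] [Fact p.Prime] :
    Nat.card (AddChar (ZMod p) (ZMod q)) = charCount q p := by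
  rw [AddChar.card_zmod, Nat.card_eq_fintype_card, ZMod.card_units, charCount]
  have hq := (Fact.out : q.Prime).one_le
  split_ifs with h
  · exact Nat.gcd_eq_right ((Nat.modEq_iff_dvd' hq).1 h.symm)
  · refine ((Fact.out : p.Prime).coprime_iff_not_dvd.2 fun hd => h ?_).symm
    exact ((Nat.modEq_iff_dvd' hq).2 hd).symm

/-- The characters of `∏ i, ZMod (p i)` which are trivial on the factors in `S`. -/
def trivialOn (S : Finset ι) (R : Type*) [CommMonoid R] : Set (AddChar (∀ i, ZMod (p i)) R) :=
  {χ | ∀ i ∈ S, ∀ x, χ (Pi.single i x) = 1}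

theorem ncard_trivialOn (S : Finset ι) (q : ℕ) [Fact q.Prime] :
    (trivialOn p S (ZMod q)).ncard = ∏ i ∈ Sᶜ, charCount q (p i) := by
  let T : ∀ i, Set (AddChar (ZMod (p i)) (ZMod q)) := fun i => if i ∈ S then {1} else Set.univ
  have h : trivialOn p S (ZMod q) = AddChar.piEquiv (fun i => ZMod (p i)) (ZMod q) ⁻¹'
      Set.univ.pi T := by
    ext χ
    simp only [trivialOn, Set.mem_ofPred_eq, Set.mem_preimage, Set.mem_univ_pi]
    refine forall_congr' fun i => ?_
    by_cases hi : i ∈ S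
    · simp only [T, hi, if_true, forall_const, Set.mem_singleton_iff]
      exact ⟨fun h => DFunLike.ext _ _ h, fun h x => DFunLike.congr_fun h x⟩
    · simp [T, hi]
  rw [h, ← Nat.card_coe_set_eq, Nat.card_preimage_of_injective (Equiv.injective _) (by simp),
    Nat.card_congr (Equiv.Set.univPi T), Nat.card_pi, ← Finset.prod_compl_mul_prod S]
  rw [Finset.prod_congr rfl (g := fun i => charCount q (p i)), Finset.prod_eq_one (s := S), mul_one]
  · intro i hi
    simp [T, hi]
  · intro i hi
    simp only [T, Finset.mem_compl.1 hi, if_false]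
    rw [Nat.card_congr (Equiv.Set.univ _), card_addChar_zmod]

instance (R : Type*) [CommMonoid R] [Finite R] : Finite (AddChar (∀ i, ZMod (p i)) R) :=
  DFunLike.finite _

/-- The possible values at `q` of a parameter with support `S`. -/
def localParam (S : Finset ι) (q : ι) : Set (AddChar (∀ i, ZMod (p i)) (ZMod (p q)) ×
    AddChar (∀ i, ZMod (p i)) (ZMod (p q))) :=
  if q ∈ S then
    (fun χ => (χ, 1)) '' (trivialOn p S (ZMod (p q)) \ {1}) ∪
      (fun χ => (1, χ)) '' (trivialOn p S (ZMod (p q)) \ {1})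
  else {1}

omit [Fintype ι] in
theorem mem_localParam {S : Finset ι} {q : ι} {x} : x ∈ localParam p S q ↔
    (x.1 = 1 ∨ x.2 = 1) ∧ (x.1 ∈ trivialOn p S (ZMod (p q)) ∧ x.2 ∈ trivialOn p S (ZMod (p q))) ∧
      (x ≠ 1 ↔ q ∈ S) := by
  have h1 : (1 : AddChar (∀ i, ZMod (p i)) (ZMod (p q))) ∈ trivialOn p S (ZMod (p q)) :=
    fun _ _ _ => rfl
  obtain ⟨a, b⟩ := x
  by_cases hq : q ∈ S
  · simp only [localParam, hq, if_true, Set.mem_union, Set.mem_image, Set.mem_sdiff,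
      Set.mem_singleton_iff, Prod.mk.injEq, ne_eq, iff_true, Prod.mk_eq_one, not_and]
    constructor
    · rintro (⟨c, ⟨hc, hc1⟩, rfl, rfl⟩ | ⟨c, ⟨hc, hc1⟩, rfl, rfl⟩) <;> simp_all
    · rintro ⟨rfl | rfl, ⟨ha, hb⟩, h⟩
      · exact .inr ⟨b, ⟨hb, h rfl⟩, rfl, rfl⟩
      · exact .inl ⟨a, ⟨ha, fun h' => h h' rfl⟩, rfl, rfl⟩
  · simp only [localParam, hq, if_false, Set.mem_singleton_iff, iff_false, not_not]
    constructor
    · intro h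
      obtain ⟨rfl, rfl⟩ := Prod.mk_eq_one.1 h
      exact ⟨.inl rfl, ⟨h1, h1⟩, rfl⟩
    · exact fun h => h.2.2

theorem ncard_localParam (S : Finset ι) (q : ι) : ((localParam p S q).ncard : ℤ) =
    if q ∈ S then 2 * (∏ i ∈ Sᶜ, (charCount (p q) (p i) : ℤ) - 1) else 1 := by
  by_cases hq : q ∈ S
  · have h1 : (1 : AddChar (∀ i, ZMod (p i)) (ZMod (p q))) ∈ trivialOn p S (ZMod (p q)) :=
      fun _ _ _ => rfl
    have h2 := Set.ncard_sdiff_singleton_add_one h1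
    rw [ncard_trivialOn] at h2
    simp only [localParam, hq, if_true]
    rw [Set.ncard_union_eq, Set.ncard_image_of_injective _ fun _ _ h => (Prod.mk.inj h).1,
      Set.ncard_image_of_injective _ fun _ _ h => (Prod.mk.inj h).2]
    · rw [← Nat.cast_prod, ← h2]
      push_cast
      ring
    · rw [Set.disjoint_left]
      rintro _ ⟨a, ha, rfl⟩ ⟨b, hb, h⟩
      exact ha.2 (Prod.mk.inj h).1.symm
  · simp [localParam, hq]

variable {p}

open Classical in
theorem isBraceParam_and_support_iff {f : ∀ i, AddChar (∀ i, ZMod (p i)) (ZMod (p i)) ×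
    AddChar (∀ i, ZMod (p i)) (ZMod (p i))} {S : Finset ι} :
    IsBraceParam p f ∧ Finset.univ.filter (fun i => f i ≠ 1) = S ↔ ∀ q, f q ∈ localParam p S q := by
  simp only [mem_localParam, Finset.ext_iff, Finset.mem_filter, Finset.mem_univ, true_and]
  constructor
  · rintro ⟨hf, hS⟩ q
    exact ⟨hf.eq_one q, ⟨fun i hi x => (hf.single i q ((hS i).2 hi) x).1,
      fun i hi x => (hf.single i q ((hS i).2 hi) x).2⟩, hS q⟩
  · exact fun h => ⟨⟨fun i => (h i).1, fun i j hi x => ⟨(h j).2.1.1 i ((h i).2.2.1 hi) x,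
      (h j).2.1.2 i ((h i).2.2.1 hi) x⟩⟩, fun i => (h i).2.2⟩

-- Sorting by the support `S`, the conditions at different primes become independent. Each `q ∈ S`
-- contributes a choice of slot and a nontrivial character trivial on the factors in `S`.
variable (p) in
theorem card_isBraceParam : (Nat.card {f // IsBraceParam p f} : ℤ) =
    ∑ S : Finset ι, ∏ q ∈ S, 2 * (∏ i ∈ Sᶜ, (charCount (p q) (p i) : ℤ) - 1) := by
  classical
  have e : {f // IsBraceParam p f} ≃ Σ S : Finset ι, ∀ q, localParam p S q :=
    (Equiv.sigmaFiberEquiv fun f : {f // IsBraceParam p f} =>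
      Finset.univ.filter fun i => f.1 i ≠ 1).symm.trans <| Equiv.sigmaCongrRight fun S =>
        ((Equiv.subtypeSubtypeEquivSubtypeInter (IsBraceParam p)
          fun f => Finset.univ.filter (fun i => f i ≠ 1) = S).trans
          (Equiv.subtypeEquivRight fun _ => isBraceParam_and_support_iff)).trans
          Equiv.subtypePiEquivPi
  rw [Nat.card_congr e, Nat.card_sigma]
  push_cast
  refine Finset.sum_congr rfl fun S _ => ?_
  rw [Nat.card_pi]
  push_cast
  simp only [Nat.card_coe_set_eq, ncard_localParam]
  rw [Finset.prod_ite_mem, Finset.univ_inter]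

/-- Brace actions on `∏ i, ZMod (p i)` correspond to parameters. -/
noncomputable def braceParamEquiv (hp : Function.Injective p) : {f // IsBraceParam p f} ≃
    {π : Multiplicative (∀ i, ZMod (p i)) → Multiplicative (∀ i, ZMod (p i)) →
      Multiplicative (∀ i, ZMod (p i)) // IsBraceAction π} :=
  Equiv.ofBijective (fun f => ⟨paramAct f.1, f.2.isBraceAction⟩)
    ⟨fun f g h => Subtype.ext (paramAct_injective f.2 g.2 (congrArg Subtype.val h)),
      fun π => by
        obtain ⟨f, hf, h⟩ := exists_paramAct_eq hp π.2
        exact ⟨⟨f, hf⟩, Subtype.ext h⟩⟩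

end Counting

/-- Expand the product over `S` by the subset `G` where the term `∏ N` is chosen. On the right each
factor is `-2 + ∏ N`; expand by the set `U` where `-2` is chosen. The two double sums match under `S
= G ∪ U`, with `G` and `U` disjoint. The right side keeps `-2` as `-1 + -1`, so that its factors
split later between `d` and `z`. -/
theorem sum_prod_compl_eq {ι : Type*} [Fintype ι] [DecidableEq ι] (N : ι → ι → ℤ) :
    ∑ S : Finset ι, ∏ q ∈ S, 2 * (∏ i ∈ Sᶜ, N q i - 1) =
      ∑ G : Finset ι, 2 ^ G.card * ∏ i ∈ Gᶜ, ((∏ q ∈ G, N q i - 1) + -1) := by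
  have h1 : ∀ S : Finset ι, ∏ q ∈ S, 2 * (∏ i ∈ Sᶜ, N q i - 1) =
      ∑ G ∈ S.powerset, 2 ^ S.card * (-1) ^ (S \ G).card * ∏ i ∈ Sᶜ, ∏ q ∈ G, N q i := fun S => by
    simp only [sub_eq_add_neg, Finset.prod_mul_distrib, Finset.prod_const, Finset.prod_add,
      Finset.mul_sum]
    refine Finset.sum_congr rfl fun G _ => ?_
    rw [Finset.prod_comm]
    ring
  have h2 : ∀ G : Finset ι, 2 ^ G.card * ∏ i ∈ Gᶜ, ((∏ q ∈ G, N q i - 1) + -1) =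
      ∑ U ∈ Gᶜ.powerset, 2 ^ (G ∪ U).card * (-1) ^ ((G ∪ U) \ G).card *
        ∏ i ∈ (G ∪ U)ᶜ, ∏ q ∈ G, N q i := fun G => by
    have h : ∀ i, (∏ q ∈ G, N q i - 1) + -1 = -2 + ∏ q ∈ G, N q i := fun i => by ring
    simp only [h, Finset.prod_add, Finset.mul_sum, Finset.prod_const]
    refine Finset.sum_congr rfl fun U hU => ?_
    have hd : Disjoint G U := Finset.disjoint_left.2 fun i hi hi' =>
      Finset.mem_compl.1 (Finset.mem_powerset.1 hU hi') hi
    rw [Finset.card_union_of_disjoint hd, Finset.union_sdiff_cancel_left hd, Finset.compl_union,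
      ← Finset.sdiff_eq_inter_compl, pow_add, neg_pow (2 : ℤ)]
    ring
  rw [Finset.sum_congr rfl fun S _ => h1 S, Finset.sum_congr rfl fun G _ => h2 G,
    Finset.sum_sigma', Finset.sum_sigma']
  refine Finset.sum_nbij' (fun x => ⟨x.2, x.1 \ x.2⟩) (fun x => ⟨x.1 ∪ x.2, x.1⟩) ?_ ?_ ?_ ?_ ?_
  · rintro ⟨S, G⟩ -
    simp only [Finset.mem_sigma, Finset.mem_univ, Finset.mem_powerset, true_and]
    exact fun i hi => Finset.mem_compl.2 (Finset.mem_sdiff.1 hi).2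
  · rintro ⟨G, U⟩ -
    simpa only [Finset.mem_sigma, Finset.mem_univ, Finset.mem_powerset, true_and] using
      Finset.subset_union_left
  · rintro ⟨S, G⟩ h
    simp only [Finset.mem_sigma, Finset.mem_univ, Finset.mem_powerset, true_and] at h
    simp [Finset.union_sdiff_of_subset h]
  · rintro ⟨G, U⟩ h
    simp only [Finset.mem_sigma, Finset.mem_univ, Finset.mem_powerset, true_and] at h
    have hd : Disjoint G U := Finset.disjoint_left.2 fun i hi hi' => Finset.mem_compl.1 (h hi') hi
    simp [Finset.union_sdiff_cancel_left hd]
  · rintro ⟨S, G⟩ h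
    simp only [Finset.mem_sigma, Finset.mem_univ, Finset.mem_powerset, true_and] at h
    simp [Finset.union_sdiff_of_subset h]

/-! ### Factorisations of a squarefree number as sets of primes -/

section ProductsOfPrimes

variable {ι : Type*} {p : ι → ℕ} [∀ i, Fact (p i).Prime]

omit [∀ i, Fact (p i).Prime] in
theorem prod_eq_prod_image [DecidableEq ι] (hp : Function.Injective p) (S : Finset ι) :
    ∏ i ∈ S, p i = ∏ q ∈ S.image p, q := by
  rw [Finset.prod_image fun _ _ _ _ h => hp h]

theorem primeFactors_prod_apply [DecidableEq ι] (hp : Function.Injective p) (S : Finset ι) :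
    (∏ i ∈ S, p i).primeFactors = S.image p := by
  rw [prod_eq_prod_image hp, Nat.primeFactors_prod fun q hq => ?_]
  obtain ⟨i, -, rfl⟩ := Finset.mem_image.1 hq
  exact Fact.out

theorem dvd_prod_iff_mem (hp : Function.Injective p) {S : Finset ι} {i : ι} :
    p i ∣ ∏ j ∈ S, p j ↔ i ∈ S := by
  rw [(Fact.out : (p i).Prime).prime.dvd_finsetProd_iff]
  refine ⟨fun ⟨j, hj, h⟩ => ?_, fun h => ⟨i, h, dvd_rfl⟩⟩
  rwa [hp ((Nat.prime_dvd_prime_iff_eq Fact.out Fact.out).1 h)]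

theorem prod_apply_injective (hp : Function.Injective p) :
    Function.Injective fun S : Finset ι => ∏ i ∈ S, p i := fun S T h => by
  ext i
  rw [← dvd_prod_iff_mem hp, ← dvd_prod_iff_mem hp (S := T)]
  exact iff_of_eq (congrArg _ h)

theorem exists_eq_prod_of_dvd [Fintype ι] (hp : Function.Injective p) {d : ℕ}
    (hd : d ∣ ∏ i, p i) : ∃ S : Finset ι, ∏ i ∈ S, p i = d := by
  classical
  have h0 := (squarefree_prod_apply hp Finset.univ).ne_zero
  refine ⟨Finset.univ.filter fun i => p i ∣ d, ?_⟩
  rw [prod_eq_prod_image hp]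
  conv_rhs => rw [← Nat.prod_primeFactors_of_squarefree
    ((squarefree_prod_apply hp Finset.univ).squarefree_of_dvd hd)]
  congr 1
  ext q
  simp only [Finset.mem_image, Finset.mem_filter, Finset.mem_univ, true_and]
  constructor
  · rintro ⟨i, hi, rfl⟩
    exact Nat.mem_primeFactors.2 ⟨Fact.out, hi, ne_zero_of_dvd_ne_zero h0 hd⟩
  · intro hq
    have h1 := Nat.primeFactors_mono hd h0 hq
    rw [primeFactors_prod_apply hp] at h1
    obtain ⟨i, -, rfl⟩ := Finset.mem_image.1 h1
    exact ⟨i, Nat.dvd_of_mem_primeFactors hq, rfl⟩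

theorem sum_orderedTripleFactorisations [Fintype ι] [DecidableEq ι] (hp : Function.Injective p)
    {M : Type*} [AddCommMonoid M] (F : ℕ × ℕ × ℕ → M) :
    ∑ t ∈ orderedTripleFactorisations (∏ i, p i), F t =
      ∑ G : Finset ι, ∑ D ∈ Gᶜ.powerset, F (∏ i ∈ D, p i, ∏ i ∈ G, p i, ∏ i ∈ Gᶜ \ D, p i) := by
  have hsq := squarefree_prod_apply hp Finset.univ
  rw [Finset.sum_sigma']
  symm
  refine Finset.sum_nbij
    (fun x : Σ _ : Finset ι, Finset ι => (∏ i ∈ x.2, p i, ∏ i ∈ x.1, p i, ∏ i ∈ x.1ᶜ \ x.2, p i))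
    ?_ ?_ ?_ (fun _ _ => rfl)
  · rintro ⟨G, D⟩ h
    simp only [Finset.mem_sigma, Finset.mem_univ, Finset.mem_powerset, true_and] at h
    rw [mem_orderedTripleFactorisations hsq.ne_zero, ← Finset.prod_mul_prod_compl G,
      ← Finset.prod_sdiff h]
    ring
  · rintro ⟨G, D⟩ - ⟨G', D'⟩ - h
    simp only [Prod.mk.injEq] at h
    obtain rfl := prod_apply_injective hp h.1
    obtain rfl := prod_apply_injective hp h.2.1
    rfl
  · rintro ⟨d, g, z⟩ h
    rw [Finset.mem_coe, mem_orderedTripleFactorisations hsq.ne_zero] at h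
    obtain ⟨D, rfl⟩ := exists_eq_prod_of_dvd hp (d := d) ⟨g * z, by rw [← h, mul_assoc]⟩
    obtain ⟨G, rfl⟩ := exists_eq_prod_of_dvd hp (d := g)
      ⟨(∏ i ∈ D, p i) * z, by rw [← h]; ring⟩
    have hD : D ⊆ Gᶜ := fun i hi => Finset.mem_compl.2 fun hi' => by
      have h1 : p i * p i ∣ ∏ i, p i := h ▸ Dvd.dvd.mul_right
        (mul_dvd_mul (Finset.dvd_prod_of_mem p hi) (Finset.dvd_prod_of_mem p hi')) z
      exact (Fact.out : (p i).Prime).one_lt.ne' (Nat.isUnit_iff.1 (hsq _ h1))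
    refine ⟨⟨G, D⟩, by simpa only [Finset.coe_sigma, Set.mem_sigma_iff, Finset.coe_univ, Set.mem_univ,
      Finset.mem_coe, Finset.mem_powerset, true_and] using hD, ?_⟩
    simp only [Prod.mk.injEq, true_and]
    rw [← Finset.prod_mul_prod_compl G, ← Finset.prod_sdiff hD] at h
    have h0 : (∏ i ∈ D, p i) * ∏ i ∈ G, p i ≠ 0 :=
      mul_ne_zero (squarefree_prod_apply hp D).ne_zero (squarefree_prod_apply hp G).ne_zero
    refine mul_left_cancel₀ h0 ?_
    rw [h]
    ring

theorem cardDistinctFactors_prod_apply (hp : Function.Injective p) (S : Finset ι) :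
    ArithmeticFunction.cardDistinctFactors (∏ i ∈ S, p i) = S.card := by
  classical
  rw [ArithmeticFunction.cardDistinctFactors_apply, ← List.card_toFinset]
  change (∏ i ∈ S, p i).primeFactors.card = _
  rw [primeFactors_prod_apply hp, Finset.card_image_of_injective _ hp]

theorem moebius_prod_apply (hp : Function.Injective p) (S : Finset ι) :
    ArithmeticFunction.moebius (∏ i ∈ S, p i) = (-1) ^ S.card := by
  rw [ArithmeticFunction.IsMultiplicative.map_prod _
    ArithmeticFunction.isMultiplicative_moebius _ fun i _ j _ hij =>
      (Nat.coprime_primes Fact.out Fact.out).2 (hp.ne hij),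
    Finset.prod_congr rfl fun i _ => ArithmeticFunction.moebius_apply_prime
      (Fact.out : (p i).Prime), Finset.prod_const]

theorem prod_charCount (hp : Function.Injective p) (S : Finset ι) (r : ℕ) :
    ∏ q ∈ S, (charCount (p q) r : ℤ) = r ^ primeFactorsOneModCount r (∏ i ∈ S, p i) := by
  classical
  rw [primeFactorsOneModCount, primeFactors_prod_apply hp, Finset.filter_image,
    Finset.card_image_of_injective _ hp]
  simp only [charCount, Nat.cast_ite, Nat.cast_one]
  rw [Finset.prod_ite, Finset.prod_const, Finset.prod_const_one, mul_one]

/-- Here `g` is the product over `G`. Expanding the factors outside `G` puts in `d` the primes where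
the power minus one is chosen, and in `z` those where `-1` is chosen, whose signs make up `μ z`. -/
theorem card_isBraceParam_eq_sum [Fintype ι] [DecidableEq ι] (hp : Function.Injective p) :
    (Nat.card {f // IsBraceParam p f} : ℤ) = ∑ t ∈ orderedTripleFactorisations (∏ i, p i),
      2 ^ (ArithmeticFunction.cardDistinctFactors t.2.1) * ArithmeticFunction.moebius t.2.2 *
        ∏ r ∈ t.1.primeFactors, ((r : ℤ) ^ primeFactorsOneModCount r t.2.1 - 1) := by
  rw [card_isBraceParam, sum_prod_compl_eq fun q i => (charCount (p q) (p i) : ℤ),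
    sum_orderedTripleFactorisations hp]
  refine Finset.sum_congr rfl fun G _ => ?_
  simp only [Finset.prod_add, Finset.mul_sum, prod_charCount hp]
  refine Finset.sum_congr rfl fun D _ => ?_
  rw [cardDistinctFactors_prod_apply hp, moebius_prod_apply hp, primeFactors_prod_apply hp,
    Finset.prod_image fun _ _ _ _ h => hp h, Finset.prod_const]
  ring

end ProductsOfPrimes

/-! ### The number of Hopf-Galois structures -/

theorem theorem1p2 (K : Type u) (L : Type v) [Field K] [Field L] [Algebra K L]
    [IsGalois K L] [IsCyclic (L ≃ₐ[K] L)] (n : ℕ) (hn : Squarefree n)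
    (hdeg : Module.finrank K L = n) :
    Finite (HopfGaloisClasses K L) ∧
      (Nat.card (HopfGaloisClasses K L) : ℤ) =
        ∑ t ∈ orderedTripleFactorisations n,
          2 ^ (ArithmeticFunction.cardDistinctFactors t.2.1) *
            ArithmeticFunction.moebius t.2.2 *
            ∏ p ∈ t.1.primeFactors, ((p : ℤ) ^ primeFactorsOneModCount p t.2.1 - 1) := by
  have : FiniteDimensional K L := .of_finrank_pos (hdeg ▸ Nat.pos_of_ne_zero hn.ne_zero)
  let p : n.primeFactors → ℕ := Subtype.val
  have hprime : ∀ i, Fact (p i).Prime := fun i => ⟨Nat.prime_of_mem_primeFactors i.2⟩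
  have hp : Function.Injective p := Subtype.val_injective
  have hprod : ∏ i, p i = n := by
    refine (Finset.prod_coe_sort n.primeFactors id).trans ?_
    exact Nat.prod_primeFactors_of_squarefree hn
  have hcard : Nat.card (L ≃ₐ[K] L) = ∏ i, p i := by
    rw [IsGalois.card_aut_eq_finrank, hdeg, hprod]
  -- By the Chinese remainder theorem, a cyclic group of squarefree order is a product of groups of
  -- distinct prime orders.
  have hcrt : ZMod (Nat.card (L ≃ₐ[K] L)) ≃+ ∀ i, ZMod (p i) := by
    rw [hcard]
    exact (ZMod.prodEquivPi p fun i j hij =>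
      (Nat.coprime_primes Fact.out Fact.out).2 (hp.ne hij)).toAddEquiv
  have e : (L ≃ₐ[K] L) ≃* Multiplicative (∀ i, ZMod (p i)) :=
    (zmodCyclicMulEquiv (G := L ≃ₐ[K] L) inferInstance).symm.trans hcrt.toMultiplicative
  obtain ⟨e'⟩ := nonempty_hopfGaloisClasses_equiv K L
  have e'' := (e'.trans (braceActionCongr e)).trans (braceParamEquiv hp).symm
  have : Finite {f // IsBraceParam p f} := Subtype.finite
  refine ⟨Finite.of_equiv _ e''.symm, ?_⟩
  rw [Nat.card_congr e'', card_isBraceParam_eq_sum hp, hprod]
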